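/- **Theorem (Duality for Bi(B)BI).** Let $\Sigma$ be any set of the subclassical axioms listed below. Then $\theta$ and $\eta$ form a dual equivalence of categories between $\mathrm{BiBIAlg}_\Sigma$ and $\mathrm{BiBISp}_\Sigma$, and likewise between $\mathrm{BiBBIAlg}_\Sigma$ and $\mathrm{BiBBISp}_\Sigma$. That is: the contravariant functors $Pr$ and $Clop$ below are well defined, the maps $\theta_A$ and $\eta_X$ are morphisms, and they are the components of natural isomorphisms $\theta:\mathrm{Id}\to Clop\,Pr$ and $\eta:\mathrm{Id}\to Pr\,Clop$ (satisfying the triangle identity $Pr(\theta_A)\circ\eta_{Pr(A)}=\mathrm{id}$). **Algebras.** A *BiBI algebra* is $(A,\wedge,\vee,\to,\top,\bot,*,\curlyvee,-\!\!*,\backslash,\top^*,\bot^*)$ where $(A,\wedge,\vee,\to,\top,\bot)$ is a Heyting algebra, $(A,*,\top^*)$ is a commutative monoid, $a*b\le c$ iff $a\le b -\!\!* c$, the operation $\curlyvee$ is commutative, and $a\le b\curlyvee c$ iff $a\backslash b\le c$. It is a *BiBBI algebra* if the Heyting algebra is Boolean. The subclassical axioms are: Associativity $a\curlyvee(b\curlyvee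 c)\le(a\curlyvee b)\curlyvee c$; $\bot^*$ Weakening $a\le a\curlyvee\bot^*$; $\bot^*$ Contraction $a\curlyvee\bot^*\le a$; $\curlyvee$ Contraction $a\curlyvee a\le a$; Weak Distributivity $a*(b\curlyvee c)\le(a*b)\curlyvee c$. $\mathrm{Bi(B)BIAlg}_\Sigma$ has as objects the Bi(B)BI algebras satisfying $\Sigma$, and as morphisms the maps preserving all operations. **Spaces.** Given a poset $X$ with maps $\circ,\triangledown:X^2\to\mathcal P(X)$, define for $A,B\subseteq X$: - $A\Rightarrow B=\{x\mid \forall x'\succcurlyeq x\,(x'\in A\to x'\in B)\}$, - $A\bullet B=\{x\mid\exists w,y,z\,(x\succcurlyeq w\in y\circ z,\ y\in A,\ z\in B)\}$, - $A \mathbin{-\!\bullet} B=\{x\mid\forall w,y,z\,(w\succcurlyeq x,\ z\in w\circ y,\ y\in A\to z\in B)\}$, and $A\mathbin{\bullet\!-}B$ in the same way with $z\in y\circ w$, - $A\blacktriangledown B=\{x\mid\forall s,t,u\,(x\preccurlyeq s\in t\triangledown u\to t\in A\text{ or }u\in B)\}$, - $A\mathbin{\blacktriangledown\!\backslash}B=\{x\mid\exists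 s,t,u\,(x\succcurlyeq s,\ u\in t\triangledown s,\ u\in A,\ t\notin B)\}$. A *$BiBI_\Sigma$ space* is $(X,\mathcal O,\preccurlyeq,\circ,E,\triangledown,U)$ such that (free variables universally quantified): 1. $(X,\mathcal O,\preccurlyeq)$ is an Esakia space: a compact topological space with a partial order such that if $x\not\preccurlyeq y$ then some clopen up-set contains $x$ but not $y$, and the down-set of each clopen set is clopen. 2. BI frame conditions: $z\in x\circ y\to z\in y\circ x$; $E$ is an up-set; for every $x$ there is $e\in E$ with $x\in x\circ e$; if $e\in E$ and $x\in y\circ e$ then $x\succcurlyeq y$; if $t'\succcurlyeq t\in x\circ y$ and $w\in t'\circ z$, there are $s,s',w'$ with $s'\succcurlyeq s\in y\circ z$ and $w\succcurlyeq w'\in x\circ s'$. 3. $z\in x\triangledown y\to z\in y\triangledown x$, and $U$ is a down-set. 4. The frame correspondents of the axioms in $\Sigma$ hold: - Associativity: if $t'\preccurlyeq t\in x\triangledown y$ and $w\in t'\triangledown z$, there are $s,s',w'$ with $s'\preccurlyeq s\in y\triangledown z$ and $w\preccurlyeq w'\in x\triangledown s'$. - $\bot^*$ Weakening: if $u\in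 U$ and $x\in y\triangledown u$ then $x\preccurlyeq y$. - $\bot^*$ Contraction: for every $w$ there is $u\in U$ with $w\in w\triangledown u$. - $\curlyvee$ Contraction: $x\in x\triangledown x$. - Weak Distributivity: if $t'\succcurlyeq t\in x_1\circ x_2$ and $t'\preccurlyeq t''\in y_1\triangledown y_2$, there is $w$ with $y_1\in x_1\circ w$ and $x_2\in w\triangledown y_2$. 5. $E$ and $U$ are clopen, and the clopen up-sets are closed under $\bullet$, $-\!\bullet$, $\bullet\!-$, $\blacktriangledown$ and $\blacktriangledown\!\backslash$. 6. If $x\notin y\circ z$, there are clopen up-sets $C_1\ni y$, $C_2\ni z$ with $x\notin C_1\bullet C_2$. If $x\notin y\triangledown z$, there are clopen up-sets $C_1\not\ni y$, $C_2\not\ni z$ with $x\in C_1\blacktriangledown C_2$. A *$BiBBI_\Sigma$ space* is a $BiBI_\Sigma$ space whose order is equality. **Morphisms of spaces** $g:X\to X'$ are the continuous maps such that 1. $x\preccurlyeq y$ implies $g(x)\preccurlyeq' g(y)$; 2. if $g(x)\preccurlyeq' y'$, there is $y\succcurlyeq x$ with $g(y)=y'$; 3. $x\in y\circ z$ implies $g(x)\in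 g(y)\circ' g(z)$; 4. if $g(x)\succcurlyeq' w'\in y'\circ' z'$, there are $w,y,z$ with $x\succcurlyeq w\in y\circ z$, $y'\preccurlyeq' g(y)$, $z'\preccurlyeq' g(z)$; 5. if $g(x)\preccurlyeq' w'$ and $z'\in w'\circ' y'$, there are $w,y,z$ with $x\preccurlyeq w$, $z\in w\circ y$, $y'\preccurlyeq' g(y)$, $g(z)\preccurlyeq' z'$; 6. the same as (5) with $y'\circ' w'$ and $y\circ w$ in place of $w'\circ' y'$ and $w\circ y$; 7. $e\in E$ iff $g(e)\in E'$; 8. $x\in y\triangledown z$ implies $g(x)\in g(y)\triangledown' g(z)$; 9. if $g(x)\preccurlyeq' s'\in t'\triangledown' u'$, there are $s,t,u$ with $x\preccurlyeq s\in t\triangledown u$, $t'\succcurlyeq' g(t)$, $u'\succcurlyeq' g(u)$; 10. if $g(x)\succcurlyeq' s'$ and $u'\in t'\triangledown' s'$, there are $s,t,u$ with $x\succcurlyeq s$, $u\in t\triangledown s$, $g(u)\succcurlyeq' u'$, $t'\succcurlyeq' g(t)$; 11. $u\in U$ iff $g(u)\in U'$. **Functors.** $Pr(A)$ is the set of prime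 filters of $A$ ordered by inclusion, with the topology generated by the sets $\{F\mid a\in F\}$ and their complements, and with - $F\circ F'=\{F''\mid \forall a\in F,\ b\in F':\ a*b\in F''\}$ and $E=\{F\mid\top^*\in F\}$, - $F\triangledown F'=\{F''\mid \forall a,b:\ a\curlyvee b\in F''\to a\in F\text{ or }b\in F'\}$ and $U=\{F\mid\bot^*\notin F\}$. $Clop(X)$ is the algebra of clopen up-sets of $X$ with operations $\cap,\cup,\Rightarrow,X,\emptyset$ and with $\bullet$, $\blacktriangledown$, $-\!\bullet$, $\blacktriangledown\!\backslash$, $E$, $X\setminus U$ interpreting $*,\curlyvee,-\!\!*,\backslash,\top^*,\bot^*$. On morphisms, $Pr(f)=f^{-1}$ and $Clop(g)=g^{-1}$. Finally, $\theta_A(a)=\{F\in Pr(A)\mid a\in F\}$ and $\eta_X(x)=\{C\in Clop(X)\mid x\in C\}$. -/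

import Mathlib

open CategoryTheory Opposite

universe u

/-! ### Algebras -/

/-- The multiplicative signature `*`, `-*`, `⅋`, `\`, `⊤*`, `⊥*` of the subclassical bunched logics
(operations only, no laws). -/
class BiOps (A : Type*) where
  /-- multiplicative conjunction `a * b` -/
  star : A → A → A
  /-- magic wand `a -* b` -/
  wand : A → A → A
  /-- multiplicative disjunction `a ⅋ b` -/
  par : A → A → A
  /-- the residual `a \ b` of multiplicative disjunction -/
  rslash : A → A → A
  /-- multiplicative truth `⊤*` -/
  mtop : A
  /-- multiplicative falsum `⊥*` -/
  mbot : A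

open BiOps

/-- Whether the additive connectives are intuitionistic (BiBI) or classical (BiBBI). -/
inductive BiVariant
  | BiBI
  | BiBBI

/-- The five optional axioms of the subclassical bunched logics. -/
inductive SubclassicalAxiom
  | associativity
  | mbotWeakening
  | mbotContraction
  | parContraction
  | weakDistributivity

/-- The algebraic form of each subclassical axiom. -/
def SubclassicalAxiom.HoldsIn (A : Type*) [HeytingAlgebra A] [BiOps A] :
    SubclassicalAxiom → Prop
  | associativity => ∀ a b c : A, par a (par b c) ≤ par (par a b) c
  | mbotWeakening => ∀ a : A, a ≤ par a mbot
  | mbotContraction => ∀ a : A, par a mbot ≤ a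
  | parContraction => ∀ a : A, par a a ≤ a
  | weakDistributivity => ∀ a b c : A, star a (par b c) ≤ par (star a b) c

/-- BI algebras: Heyting algebras with a residuated commutative monoid. -/
structure IsBIAlgebra (A : Type*) [HeytingAlgebra A] [BiOps A] : Prop where
  star_comm : ∀ a b : A, star a b = star b a
  star_assoc : ∀ a b c : A, star (star a b) c = star a (star b c)
  star_mtop : ∀ a : A, star a mtop = a
  le_wand_iff : ∀ a b c : A, star a b ≤ c ↔ a ≤ wand b c
  le_wand_iff' : ∀ a b c : A, star a b ≤ c ↔ b ≤ wand a c

/-- Basic BiBI algebras. -/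
structure IsBasicBiBIAlgebra (A : Type*) [HeytingAlgebra A] [BiOps A] : Prop
    extends IsBIAlgebra A where
  par_comm : ∀ a b : A, par a b = par b a
  rslash_le_iff : ∀ a b c : A, a ≤ par b c ↔ rslash a b ≤ c

/-- BiBI algebras (respectively, BiBBI algebras) satisfying the axioms in `Ax`.
In the BiBBI case the underlying Heyting algebra is a Boolean algebra. -/
structure IsBiAlgebra (v : BiVariant) (Ax : Set SubclassicalAxiom)
    (A : Type*) [HeytingAlgebra A] [BiOps A] : Prop extends IsBasicBiBIAlgebra A where
  boolean : v = BiVariant.BiBBI → ∀ a : A, a ⊔ aᶜ = ⊤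
  holds : ∀ σ ∈ Ax, σ.HoldsIn A

/-- Homomorphisms: maps preserving all operations of the signature. -/
structure IsBiAlgHom {A B : Type*} [HeytingAlgebra A] [BiOps A] [HeytingAlgebra B] [BiOps B]
    (f : A → B) : Prop where
  map_inf : ∀ a b, f (a ⊓ b) = f a ⊓ f b
  map_sup : ∀ a b, f (a ⊔ b) = f a ⊔ f b
  map_himp : ∀ a b, f (a ⇨ b) = f a ⇨ f b
  map_top : f ⊤ = ⊤
  map_bot : f ⊥ = ⊥
  map_star : ∀ a b, f (star a b) = star (f a) (f b)
  map_wand : ∀ a b, f (wand a b) = wand (f a) (f b)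
  map_par : ∀ a b, f (par a b) = par (f a) (f b)
  map_rslash : ∀ a b, f (rslash a b) = rslash (f a) (f b)
  map_mtop : f mtop = mtop
  map_mbot : f mbot = mbot

/-- Objects of the category `Bi(B)BIAlg_Ax`. -/
structure BiAlg (v : BiVariant) (Ax : Set SubclassicalAxiom) where
  carrier : Type u
  [heyting : HeytingAlgebra carrier]
  [ops : BiOps carrier]
  isBiAlgebra : IsBiAlgebra v Ax carrier

namespace BiAlg

variable {v : BiVariant} {Ax : Set SubclassicalAxiom}

instance : CoeSort (BiAlg.{u} v Ax) (Type u) := ⟨BiAlg.carrier⟩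

attribute [instance] BiAlg.heyting BiAlg.ops

/-- Morphisms of `Bi(B)BIAlg_Ax`. -/
@[ext]
structure Hom (A B : BiAlg.{u} v Ax) where
  toFun : A → B
  isHom : IsBiAlgHom toFun

instance : Category (BiAlg.{u} v Ax) where
  Hom := Hom
  id A := ⟨id, by constructor <;> intros <;> rfl⟩
  comp f g := ⟨g.toFun ∘ f.toFun, by
    have hf := f.isHom
    have hg := g.isHom
    constructor <;> intros <;>
      simp only [Function.comp_apply, hf.map_inf, hg.map_inf, hf.map_sup, hg.map_sup,
        hf.map_himp, hg.map_himp, hf.map_top, hg.map_top, hf.map_bot, hg.map_bot, hf.map_star,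
        hg.map_star, hf.map_wand, hg.map_wand, hf.map_par, hg.map_par, hf.map_rslash,
        hg.map_rslash, hf.map_mtop, hg.map_mtop, hf.map_mbot, hg.map_mbot]⟩

end BiAlg

/-! ### Frames and complex operations -/

/-- The relational signature `∘`, `E`, `▽`, `U` (no laws). -/
class BiFrameStr (X : Type*) where
  /-- the composition `x ∘ y` -/
  comp : X → X → Set X
  /-- the unit set `E` -/
  E : Set X
  /-- the co-composition `x ▽ y` -/
  cocomp : X → X → Set X
  /-- the set `U` interpreting multiplicative falsum -/
  U : Set X

open BiFrameStr

section Frames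

variable {X : Type*} [Preorder X]

/-- `A ⇒ B` -/
def cHimp (A B : Set X) : Set X := {x | ∀ x', x ≤ x' → x' ∈ A → x' ∈ B}

variable [BiFrameStr X]

/-- `A • B` -/
def cStar (A B : Set X) : Set X :=
  {x | ∃ w y z : X, w ≤ x ∧ w ∈ comp y z ∧ y ∈ A ∧ z ∈ B}

/-- `A -• B` -/
def cWand (A B : Set X) : Set X :=
  {x | ∀ w y z : X, x ≤ w → z ∈ comp w y → y ∈ A → z ∈ B}

/-- `A •- B` -/
def cDnaw (A B : Set X) : Set X :=
  {x | ∀ w y z : X, x ≤ w → z ∈ comp y w → y ∈ A → z ∈ B}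

/-- `A ▼ B` -/
def cPar (A B : Set X) : Set X :=
  {x | ∀ s t u : X, x ≤ s → s ∈ cocomp t u → t ∈ A ∨ u ∈ B}

/-- The residual of `▼`. -/
def cRslash (A B : Set X) : Set X :=
  {x | ∃ s t u : X, s ≤ x ∧ u ∈ cocomp t s ∧ u ∈ A ∧ t ∉ B}

theorem isUpperSet_cStar (A B : Set X) : IsUpperSet (cStar A B) :=
  fun _ _ h ⟨w, y, z, hw, h'⟩ => ⟨w, y, z, hw.trans h, h'⟩

theorem isUpperSet_cWand (A B : Set X) : IsUpperSet (cWand A B) :=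
  fun _ _ h hx w y z hw => hx w y z (h.trans hw)

theorem isUpperSet_cPar (A B : Set X) : IsUpperSet (cPar A B) :=
  fun _ _ h hx s t u hs => hx s t u (h.trans hs)

theorem isUpperSet_cRslash (A B : Set X) : IsUpperSet (cRslash A B) :=
  fun _ _ h ⟨s, t, u, hs, h'⟩ => ⟨s, t, u, hs.trans h, h'⟩

end Frames

/-- BI frames. -/
class BIFrame (X : Type*) [Preorder X] [BiFrameStr X] : Prop where
  comp_comm : ∀ x y z : X, z ∈ comp x y → z ∈ comp y x
  E_upper : ∀ e e' : X, e ∈ (E : Set X) → e ≤ e' → e' ∈ (E : Set X)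
  unit_exists : ∀ x : X, ∃ e ∈ (E : Set X), x ∈ comp x e
  coherence : ∀ x y e : X, e ∈ (E : Set X) → x ∈ comp y e → y ≤ x
  comp_assoc : ∀ x y z t t' w : X, t ≤ t' → t ∈ comp x y → w ∈ comp t' z →
    ∃ s s' w' : X, s ≤ s' ∧ s ∈ comp y z ∧ w' ≤ w ∧ w' ∈ comp x s'

/-- Basic BiBI frames. -/
class BasicBiBIFrame (X : Type*) [Preorder X] [BiFrameStr X] : Prop extends BIFrame X where
  cocomp_comm : ∀ x y z : X, z ∈ cocomp x y → z ∈ cocomp y x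
  U_lower : ∀ u u' : X, u ∈ (U : Set X) → u' ≤ u → u' ∈ (U : Set X)

/-- The frame correspondent of each subclassical axiom. -/
def SubclassicalAxiom.FrameHolds (X : Type*) [Preorder X] [BiFrameStr X] :
    SubclassicalAxiom → Prop
  | associativity => ∀ x y z t t' w : X, t' ≤ t → t ∈ cocomp x y → w ∈ cocomp t' z →
      ∃ s s' w' : X, s' ≤ s ∧ s ∈ cocomp y z ∧ w ≤ w' ∧ w' ∈ cocomp x s'
  | mbotWeakening => ∀ x y u : X, u ∈ (U : Set X) → x ∈ cocomp y u → x ≤ y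
  | mbotContraction => ∀ w : X, ∃ u ∈ (U : Set X), w ∈ cocomp w u
  | parContraction => ∀ x : X, x ∈ cocomp x x
  | weakDistributivity => ∀ x₁ x₂ y₁ y₂ t t' t'' : X,
      t ≤ t' → t ∈ comp x₁ x₂ → t' ≤ t'' → t'' ∈ cocomp y₁ y₂ →
      ∃ w : X, y₁ ∈ comp x₁ w ∧ x₂ ∈ cocomp w y₂

/-! ### Spaces -/

/-- Esakia spaces: compact Priestley spaces in which the down-set of a clopen set is clopen. -/
class EsakiaSpace (X : Type*) [TopologicalSpace X] [PartialOrder X] : Prop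
    extends CompactSpace X, PriestleySpace X where
  isClopen_lowerClosure : ∀ C : Set X, IsClopen C → IsClopen (lowerClosure C : Set X)

/-- ILGL spaces. -/
class ILGLSpace (X : Type*) [TopologicalSpace X] [PartialOrder X] [BiFrameStr X] : Prop
    extends EsakiaSpace X where
  isClopen_cStar : ∀ C D : ClopenUpperSet X, IsClopen (cStar (C : Set X) D)
  isClopen_cWand : ∀ C D : ClopenUpperSet X, IsClopen (cWand (C : Set X) D)
  isClopen_cDnaw : ∀ C D : ClopenUpperSet X, IsClopen (cDnaw (C : Set X) D)
  comp_separation : ∀ x y z : X, x ∉ comp y z →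
    ∃ C₁ C₂ : ClopenUpperSet X, y ∈ C₁ ∧ z ∈ C₂ ∧ x ∉ cStar (C₁ : Set X) C₂

/-- BI spaces. -/
class BISpace (X : Type*) [TopologicalSpace X] [PartialOrder X] [BiFrameStr X] : Prop
    extends ILGLSpace X, BIFrame X where
  isClopen_E : IsClopen (E : Set X)

/-- BiBI spaces (for the empty set of axioms). -/
class BasicBiBISpace (X : Type*) [TopologicalSpace X] [PartialOrder X] [BiFrameStr X] : Prop
    extends BISpace X, BasicBiBIFrame X where
  isClopen_cPar : ∀ C D : ClopenUpperSet X, IsClopen (cPar (C : Set X) D)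
  isClopen_cRslash : ∀ C D : ClopenUpperSet X, IsClopen (cRslash (C : Set X) D)
  isClopen_U : IsClopen (U : Set X)
  cocomp_separation : ∀ x y z : X, x ∉ cocomp y z →
    ∃ C₁ C₂ : ClopenUpperSet X, y ∉ C₁ ∧ z ∉ C₂ ∧ x ∈ cPar (C₁ : Set X) C₂

/-- `BiBI_Ax` spaces (respectively, `BiBBI_Ax` spaces).
In the BiBBI case the order is equality. -/
structure IsBiSpace (v : BiVariant) (Ax : Set SubclassicalAxiom)
    (X : Type*) [TopologicalSpace X] [PartialOrder X] [BiFrameStr X] : Prop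
    extends BasicBiBISpace X where
  discrete : v = BiVariant.BiBBI → ∀ x y : X, x ≤ y → x = y
  holds : ∀ σ ∈ Ax, σ.FrameHolds X

/-- Morphisms of spaces: continuous Bi(B)BI frame morphisms. When both orders are equality, the
conditions reduce to those for BiBBI morphisms. -/
structure IsBiSpaceHom {X Y : Type*} [TopologicalSpace X] [PartialOrder X] [BiFrameStr X]
    [TopologicalSpace Y] [PartialOrder Y] [BiFrameStr Y] (g : X → Y) : Prop where
  continuous : Continuous g
  mono : ∀ x y, x ≤ y → g x ≤ g y
  back : ∀ x y', g x ≤ y' → ∃ y, x ≤ y ∧ g y = y'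
  comp_forth : ∀ x y z, x ∈ comp y z → g x ∈ comp (g y) (g z)
  comp_back : ∀ x w' y' z', w' ≤ g x → w' ∈ comp y' z' →
    ∃ w y z, w ≤ x ∧ w ∈ comp y z ∧ y' ≤ g y ∧ z' ≤ g z
  wand_back : ∀ x w' y' z', g x ≤ w' → z' ∈ comp w' y' →
    ∃ w y z, x ≤ w ∧ z ∈ comp w y ∧ y' ≤ g y ∧ g z ≤ z'
  dnaw_back : ∀ x w' y' z', g x ≤ w' → z' ∈ comp y' w' →
    ∃ w y z, x ≤ w ∧ z ∈ comp y w ∧ y' ≤ g y ∧ g z ≤ z'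
  mem_E_iff : ∀ e, e ∈ (E : Set X) ↔ g e ∈ (E : Set Y)
  cocomp_forth : ∀ x y z, x ∈ cocomp y z → g x ∈ cocomp (g y) (g z)
  par_back : ∀ x s' t' u', g x ≤ s' → s' ∈ cocomp t' u' →
    ∃ s t u, x ≤ s ∧ s ∈ cocomp t u ∧ g t ≤ t' ∧ g u ≤ u'
  rslash_back : ∀ x s' t' u', s' ≤ g x → u' ∈ cocomp t' s' →
    ∃ s t u, s ≤ x ∧ u ∈ cocomp t s ∧ u' ≤ g u ∧ g t ≤ t'
  mem_U_iff : ∀ e, e ∈ (U : Set X) ↔ g e ∈ (U : Set Y)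

theorem IsBiSpaceHom.id (X : Type*) [TopologicalSpace X] [PartialOrder X] [BiFrameStr X] :
    IsBiSpaceHom (id : X → X) where
  continuous := continuous_id
  mono _ _ h := h
  back _ y' h := ⟨y', h, rfl⟩
  comp_forth _ _ _ h := h
  comp_back _ w' y' z' h h' := ⟨w', y', z', h, h', le_rfl, le_rfl⟩
  wand_back _ w' y' z' h h' := ⟨w', y', z', h, h', le_rfl, le_rfl⟩
  dnaw_back _ w' y' z' h h' := ⟨w', y', z', h, h', le_rfl, le_rfl⟩
  mem_E_iff _ := Iff.rfl
  cocomp_forth _ _ _ h := h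
  par_back _ s' t' u' h h' := ⟨s', t', u', h, h', le_rfl, le_rfl⟩
  rslash_back _ s' t' u' h h' := ⟨s', t', u', h, h', le_rfl, le_rfl⟩
  mem_U_iff _ := Iff.rfl

theorem IsBiSpaceHom.comp {X Y Z : Type*} [TopologicalSpace X] [PartialOrder X] [BiFrameStr X]
    [TopologicalSpace Y] [PartialOrder Y] [BiFrameStr Y]
    [TopologicalSpace Z] [PartialOrder Z] [BiFrameStr Z] {h : Y → Z} {g : X → Y}
    (hh : IsBiSpaceHom h) (hg : IsBiSpaceHom g) : IsBiSpaceHom (h ∘ g) where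
  continuous := hh.continuous.comp hg.continuous
  mono _ _ k := hh.mono _ _ (hg.mono _ _ k)
  back x y' k := by
    obtain ⟨y, h1, rfl⟩ := hh.back _ _ k
    obtain ⟨z, h2, rfl⟩ := hg.back _ _ h1
    exact ⟨z, h2, rfl⟩
  comp_forth _ _ _ k := hh.comp_forth _ _ _ (hg.comp_forth _ _ _ k)
  comp_back x w' y' z' k k' := by
    obtain ⟨w, y, z, h1, h2, h3, h4⟩ := hh.comp_back _ _ _ _ k k'
    obtain ⟨a, b, c, g1, g2, g3, g4⟩ := hg.comp_back _ _ _ _ h1 h2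
    exact ⟨a, b, c, g1, g2, h3.trans (hh.mono _ _ g3), h4.trans (hh.mono _ _ g4)⟩
  wand_back x w' y' z' k k' := by
    obtain ⟨w, y, z, h1, h2, h3, h4⟩ := hh.wand_back _ _ _ _ k k'
    obtain ⟨a, b, c, g1, g2, g3, g4⟩ := hg.wand_back _ _ _ _ h1 h2
    exact ⟨a, b, c, g1, g2, h3.trans (hh.mono _ _ g3), (hh.mono _ _ g4).trans h4⟩
  dnaw_back x w' y' z' k k' := by
    obtain ⟨w, y, z, h1, h2, h3, h4⟩ := hh.dnaw_back _ _ _ _ k k'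
    obtain ⟨a, b, c, g1, g2, g3, g4⟩ := hg.dnaw_back _ _ _ _ h1 h2
    exact ⟨a, b, c, g1, g2, h3.trans (hh.mono _ _ g3), (hh.mono _ _ g4).trans h4⟩
  mem_E_iff _ := (hg.mem_E_iff _).trans (hh.mem_E_iff _)
  cocomp_forth _ _ _ k := hh.cocomp_forth _ _ _ (hg.cocomp_forth _ _ _ k)
  par_back x s' t' u' k k' := by
    obtain ⟨w, y, z, h1, h2, h3, h4⟩ := hh.par_back _ _ _ _ k k'
    obtain ⟨a, b, c, g1, g2, g3, g4⟩ := hg.par_back _ _ _ _ h1 h2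
    exact ⟨a, b, c, g1, g2, (hh.mono _ _ g3).trans h3, (hh.mono _ _ g4).trans h4⟩
  rslash_back x s' t' u' k k' := by
    obtain ⟨w, y, z, h1, h2, h3, h4⟩ := hh.rslash_back _ _ _ _ k k'
    obtain ⟨a, b, c, g1, g2, g3, g4⟩ := hg.rslash_back _ _ _ _ h1 h2
    exact ⟨a, b, c, g1, g2, h3.trans (hh.mono _ _ g3), (hh.mono _ _ g4).trans h4⟩
  mem_U_iff _ := (hg.mem_U_iff _).trans (hh.mem_U_iff _)

/-- Objects of the category `Bi(B)BISp_Ax`. -/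
structure BiSp (v : BiVariant) (Ax : Set SubclassicalAxiom) where
  carrier : Type u
  [top : TopologicalSpace carrier]
  [order : PartialOrder carrier]
  [str : BiFrameStr carrier]
  isBiSpace : IsBiSpace v Ax carrier

namespace BiSp

variable {v : BiVariant} {Ax : Set SubclassicalAxiom}

instance : CoeSort (BiSp.{u} v Ax) (Type u) := ⟨BiSp.carrier⟩

attribute [instance] BiSp.top BiSp.order BiSp.str

instance (X : BiSp.{u} v Ax) : BasicBiBISpace X := X.isBiSpace.toBasicBiBISpace

/-- Morphisms of `Bi(B)BISp_Ax`. -/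
@[ext]
structure Hom (X Y : BiSp.{u} v Ax) where
  toFun : X → Y
  isHom : IsBiSpaceHom toFun

instance : Category (BiSp.{u} v Ax) where
  Hom := Hom
  id X := ⟨id, IsBiSpaceHom.id X⟩
  comp f g := ⟨g.toFun ∘ f.toFun, g.isHom.comp f.isHom⟩

end BiSp

/-! ### The prime filter space of an algebra -/

/-- Prime filters, ordered by inclusion. -/
def PrimeFilter (A : Type*) [HeytingAlgebra A] : Type _ := {F : Order.PFilter A // F.IsPrime}

namespace PrimeFilter

section

variable {A B : Type*} [HeytingAlgebra A] [HeytingAlgebra B]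

instance : SetLike (PrimeFilter A) A where
  coe F := F.1
  coe_injective _ _ h := Subtype.ext (SetLike.coe_injective h)

instance : PartialOrder (PrimeFilter A) := .ofSetLike (PrimeFilter A) A

/-- A nonempty proper upwards-closed subset, closed under meets, that is prime for joins. -/
def ofSet (F : Set A) (htop : ⊤ ∈ F) (hbot : ⊥ ∉ F) (hup : ∀ a b, a ≤ b → a ∈ F → b ∈ F)
    (hinf : ∀ a b, a ∈ F → b ∈ F → a ⊓ b ∈ F) (hsup : ∀ a b, a ⊔ b ∈ F → a ∈ F ∨ b ∈ F) :
    PrimeFilter A :=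
  ⟨(Order.IsPFilter.of_def (F := F) ⟨⊤, htop⟩
      (fun a ha b hb => ⟨a ⊓ b, hinf a b ha hb, inf_le_left, inf_le_right⟩)
      (fun {a b} h ha => hup a b h ha)).toPFilter,
    ⟨⟨fun a b hba ha hb => ha (hup b a hba hb), ⟨⊥, hbot⟩,
      fun a ha b hb => ⟨a ⊔ b, fun h => (hsup a b h).elim ha hb, le_sup_left, le_sup_right⟩⟩⟩⟩

theorem mem_ofSet {F : Set A} {htop hbot hup hinf hsup} {a : A} :
    a ∈ ofSet F htop hbot hup hinf hsup ↔ a ∈ F := Iff.rfl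

theorem top_mem (F : PrimeFilter A) : ⊤ ∈ F := Order.PFilter.top_mem (F := F.1)

theorem mem_of_le (F : PrimeFilter A) {a b : A} (h : a ≤ b) (ha : a ∈ F) : b ∈ F :=
  Order.PFilter.mem_of_le (F := F.1) h ha

theorem inf_mem (F : PrimeFilter A) {a b : A} (ha : a ∈ F) (hb : b ∈ F) : a ⊓ b ∈ F :=
  Order.PFilter.inf_mem (F := F.1) ha hb

theorem bot_notMem (F : PrimeFilter A) : ⊥ ∉ F := fun h => by
  obtain ⟨a, ha⟩ := F.2.compl_ideal.Nonempty
  exact ha (F.mem_of_le bot_le h)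

theorem mem_or_mem (F : PrimeFilter A) {a b : A} (h : a ⊔ b ∈ F) : a ∈ F ∨ b ∈ F := by
  by_contra! hc
  obtain ⟨c, hc', hac, hbc⟩ := F.2.compl_ideal.Directed a hc.1 b hc.2
  exact hc' (F.mem_of_le (sup_le hac hbc) h)

/-- The inverse image of a prime filter along a lattice homomorphism. -/
def comap (f : A → B) (h_inf : ∀ a b, f (a ⊓ b) = f a ⊓ f b)
    (h_sup : ∀ a b, f (a ⊔ b) = f a ⊔ f b) (h_top : f ⊤ = ⊤) (h_bot : f ⊥ = ⊥)
    (F : PrimeFilter B) : PrimeFilter A :=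
  ofSet (f ⁻¹' (F : Set B))
    (by simpa [h_top] using F.top_mem)
    (by simpa [h_bot] using F.bot_notMem)
    (fun a b hab ha => F.mem_of_le
      (by rw [← inf_eq_left, ← h_inf, inf_eq_left.2 hab]) ha)
    (fun a b ha hb => by
      simp only [Set.mem_preimage, h_inf, SetLike.mem_coe] at *; exact F.inf_mem ha hb)
    (fun a b h => by
      simp only [Set.mem_preimage, h_sup, SetLike.mem_coe] at *; exact F.mem_or_mem h)

/-- The set of prime filters containing `a`. -/
def basic (a : A) : Set (PrimeFilter A) := {F | a ∈ F}

/-- The topology with subbase the sets `basic a` and their complements. -/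
instance : TopologicalSpace (PrimeFilter A) :=
  TopologicalSpace.generateFrom {S | ∃ a : A, S = basic a ∨ S = (basic a)ᶜ}

theorem isClopen_basic (a : A) : IsClopen (basic a) :=
  ⟨⟨TopologicalSpace.isOpen_generateFrom_of_mem ⟨a, Or.inr rfl⟩⟩,
    TopologicalSpace.isOpen_generateFrom_of_mem ⟨a, Or.inl rfl⟩⟩

/-- The map `θ`, sending `a` to the clopen upper set of prime filters containing `a`. -/
def theta (a : A) : ClopenUpperSet (PrimeFilter A) :=
  ⟨⟨basic a, isClopen_basic a⟩, fun _ _ h ha => h ha⟩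

end

instance (A : Type*) [HeytingAlgebra A] [BiOps A] : BiFrameStr (PrimeFilter A) where
  comp F F' := {F'' | ∀ a ∈ F, ∀ b ∈ F', star a b ∈ F''}
  E := {F | mtop ∈ F}
  cocomp F F' := {F'' | ∀ a b : A, par a b ∈ F'' → a ∈ F ∨ b ∈ F'}
  U := {F | mbot ∉ F}

end PrimeFilter

/-! ### The algebra of clopen upper sets of a space -/

namespace ClopenUpperSet

section Esakia

variable {X : Type*} [TopologicalSpace X] [PartialOrder X]

instance : DistribLattice (ClopenUpperSet X) :=
  { (inferInstance : Lattice (ClopenUpperSet X)) with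
    le_sup_inf := fun a b c => by
      have h : ((a ⊔ b) ⊓ (a ⊔ c) : Set X) ⊆ (a ⊔ (b ⊓ c) : Set X) := le_sup_inf
      exact h }

theorem isClopen_cHimp [EsakiaSpace X] (C D : ClopenUpperSet X) :
    IsClopen (cHimp (C : Set X) D) := by
  have h := EsakiaSpace.isClopen_lowerClosure _ (C.isClopen.inter D.isClopen.compl)
  convert h.compl using 1
  ext x
  simp only [cHimp, Set.mem_ofPred_eq, Set.mem_compl_iff, SetLike.mem_coe, mem_lowerClosure,
    Set.mem_inter_iff, not_exists, not_and]
  constructor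
  · intro hx y hy hxy
    exact hy.2 (hx y hxy hy.1)
  · intro hx y hxy hy
    by_contra hD
    exact hx y ⟨hy, hD⟩ hxy

/-- The Heyting algebra of clopen upper sets of an Esakia space. -/
instance [EsakiaSpace X] : HeytingAlgebra (ClopenUpperSet X) :=
  HeytingAlgebra.ofHImp
    (fun C D => ⟨⟨cHimp (C : Set X) D, isClopen_cHimp C D⟩,
      fun _ _ h hx x' hx' => hx x' (h.trans hx')⟩)
    (fun A B C => by
      constructor
      · intro h x hx
        have h1 : x ∈ cHimp (B : Set X) C := h (show x ∈ (A : Set X) from hx.1)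
        exact h1 x le_rfl hx.2
      · intro h x hx x' hx' hB
        exact h (show x' ∈ (A ⊓ B : Set X) from ⟨A.upper hx' hx, hB⟩))

end Esakia

section

variable {X Y : Type*} [TopologicalSpace X] [PartialOrder X] [TopologicalSpace Y] [PartialOrder Y]

/-- The inverse image of a clopen upper set along a continuous monotone map. -/
def comap (g : X → Y) (hc : Continuous g) (hm : ∀ x y, x ≤ y → g x ≤ g y)
    (C : ClopenUpperSet Y) : ClopenUpperSet X :=
  ⟨⟨g ⁻¹' (C : Set Y), C.isClopen.preimage hc⟩, fun _ _ h hx => C.upper (hm _ _ h) hx⟩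

/-- The map `η`, sending `x` to the prime filter of clopen upper sets containing `x`. -/
def eta [EsakiaSpace X] (x : X) : PrimeFilter (ClopenUpperSet X) :=
  PrimeFilter.ofSet {C | x ∈ C} (Set.mem_univ x) (Set.notMem_empty x) (fun _ _ h hx => h hx)
    (fun _ _ h h' => ⟨h, h'⟩) (fun _ _ h => h)

end

instance (X : Type*) [TopologicalSpace X] [PartialOrder X] [BiFrameStr X] [BasicBiBISpace X] :
    BiOps (ClopenUpperSet X) where
  star C D := ⟨⟨cStar (C : Set X) D, ILGLSpace.isClopen_cStar C D⟩, isUpperSet_cStar _ _⟩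
  wand C D := ⟨⟨cWand (C : Set X) D, ILGLSpace.isClopen_cWand C D⟩, isUpperSet_cWand _ _⟩
  par C D := ⟨⟨cPar (C : Set X) D, BasicBiBISpace.isClopen_cPar C D⟩, isUpperSet_cPar _ _⟩
  rslash C D :=
    ⟨⟨cRslash (C : Set X) D, BasicBiBISpace.isClopen_cRslash C D⟩, isUpperSet_cRslash _ _⟩
  mtop := ⟨⟨E, BISpace.isClopen_E⟩, fun e e' h he => BIFrame.E_upper e e' he h⟩
  mbot := ⟨⟨(U : Set X)ᶜ, BasicBiBISpace.isClopen_U.compl⟩,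
    fun u u' h hu hu' => hu (BasicBiBIFrame.U_lower u' u hu' h)⟩

end ClopenUpperSet

/-! ### The functors and the notion of dual equivalence -/

section Functors

variable {v : BiVariant} {Ax : Set SubclassicalAxiom}

/-- The map `f⁻¹` on prime filters induced by a homomorphism `f`. -/
def prMap {A B : BiAlg.{u} v Ax} (f : A ⟶ B) : PrimeFilter B → PrimeFilter A :=
  PrimeFilter.comap f.toFun f.isHom.map_inf f.isHom.map_sup f.isHom.map_top f.isHom.map_bot

/-- The map `g⁻¹` on clopen upper sets induced by a morphism of spaces `g`. -/
def clopMap {X Y : BiSp.{u} v Ax} (g : X ⟶ Y) : ClopenUpperSet Y → ClopenUpperSet X :=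
  ClopenUpperSet.comap g.toFun g.isHom.continuous g.isHom.mono

/-- The contravariant functor `Pr`, given that it is well defined on objects and morphisms. -/
def prFunctor (hobj : ∀ A : BiAlg.{u} v Ax, IsBiSpace v Ax (PrimeFilter A))
    (hmap : ∀ (A B : BiAlg.{u} v Ax) (f : A ⟶ B), IsBiSpaceHom (prMap f)) :
    BiAlg.{u} v Ax ⥤ (BiSp.{u} v Ax)ᵒᵖ where
  obj A := op ⟨PrimeFilter A, hobj A⟩
  map {A B} f := Quiver.Hom.op (⟨prMap f, hmap A B f⟩ :
    BiSp.Hom ⟨PrimeFilter B, hobj B⟩ ⟨PrimeFilter A, hobj A⟩)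

/-- The contravariant functor `Clop`, given that it is well defined on objects and morphisms. -/
def clopFunctor (hobj : ∀ X : BiSp.{u} v Ax, IsBiAlgebra v Ax (ClopenUpperSet X))
    (hmap : ∀ (X Y : BiSp.{u} v Ax) (g : X ⟶ Y), IsBiAlgHom (clopMap g)) :
    (BiSp.{u} v Ax)ᵒᵖ ⥤ BiAlg.{u} v Ax where
  obj X := ⟨ClopenUpperSet X.unop, hobj X.unop⟩
  map {X Y} g := (⟨clopMap g.unop, hmap Y.unop X.unop g.unop⟩ :
    BiAlg.Hom ⟨ClopenUpperSet X.unop, hobj X.unop⟩ ⟨ClopenUpperSet Y.unop, hobj Y.unop⟩)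

end Functors

/-- The families of morphisms `θ_A : A ⟶ G F A` and `η_X : X ⟶ F G X` form a dual equivalence
between `C` and `D`, with contravariant functors `F` and `G`: they are the components of natural
isomorphisms satisfying the triangle identity, so that `(F, G, θ, η)` is an (adjoint) equivalence
of `C` with the opposite of `D`. -/
def IsDualEquivalence {C D : Type*} [Category C] [Category D] (F : C ⥤ Dᵒᵖ) (G : Dᵒᵖ ⥤ C)
    (θ : ∀ A : C, A ⟶ G.obj (F.obj A)) (η : ∀ X : D, X ⟶ (F.obj (G.obj (op X))).unop) : Prop :=
  ∃ (unit : 𝟭 C ≅ F ⋙ G) (counit : G ⋙ F ≅ 𝟭 Dᵒᵖ)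
    (triangle : ∀ A : C, F.map (unit.hom.app A) ≫ counit.hom.app (F.obj A) = 𝟙 (F.obj A)),
    let e : C ≌ Dᵒᵖ :=
      { functor := F
        inverse := G
        unitIso := unit
        counitIso := counit
        functor_unitIso_comp := triangle }
    (∀ A : C, e.unitIso.hom.app A = θ A) ∧
      ∀ X : D, e.counitIso.hom.app (op X) = (η X).op

/-! This is Esakia duality with the multiplicative relations added. Two mechanisms carry it: prime
separation on the algebra side, compactness on the space side.

Prime separation (`exists_of_disjoint`) puts a prime filter around any down-directed set none of
whose elements lies below an element of a given up-directed set. Residuation makes `*` preserve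
finite joins and `⅋` finite meets in each argument. Hence the elements that spoil membership in a
product with a given factor form an ideal, dually a filter, and a base can be extended to a prime
filter without leaving the relation (`exists_star_right`, `exists_par_right`). Each existential
claim about the prime filter space (the complex operations on basic sets, the frame conditions, the
back conditions for `f⁻¹`) reduces to such an extension.

Compactness makes every clopen up-set of prime filters basic, so that `θ` is bijective, and makes
every prime filter of clopen up-sets come from a point, so that `η` is bijective. Then `θ` is a
homomorphism because complex operations on basic sets compute the algebra operations, and `η`
reflects `∘` and `▽` because of the two separation axioms for spaces. All the maps are inverse
images or membership, so naturality and the triangle identity unfold to identities. -/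

/-! ### Separation by prime filters -/

/-- A nonempty down-directed subset. -/
structure IsFilterBase {A : Type*} [Preorder A] (S : Set A) : Prop where
  nonempty : S.Nonempty
  directed : ∀ a ∈ S, ∀ b ∈ S, ∃ c ∈ S, c ≤ a ∧ c ≤ b

/-- A nonempty up-directed subset. -/
structure IsIdealBase {A : Type*} [Preorder A] (T : Set A) : Prop where
  nonempty : T.Nonempty
  directed : ∀ a ∈ T, ∀ b ∈ T, ∃ c ∈ T, a ≤ c ∧ b ≤ c

theorem IsFilterBase.singleton {A : Type*} [Preorder A] (a : A) : IsFilterBase {a} :=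
  ⟨⟨a, rfl⟩, by rintro _ rfl _ rfl; exact ⟨_, rfl, le_rfl, le_rfl⟩⟩

theorem IsIdealBase.singleton {A : Type*} [Preorder A] (a : A) : IsIdealBase {a} :=
  ⟨⟨a, rfl⟩, by rintro _ rfl _ rfl; exact ⟨_, rfl, le_rfl, le_rfl⟩⟩

/-- Bases are used in place of filters and ideals because directedness, unlike closure upwards or
downwards, survives images under monotone maps. The sets to be separated later are such images,
under `*`, `⅋`, `⊓` or a homomorphism. -/
theorem IsFilterBase.image {A B : Type*} [Preorder A] [Preorder B] {S : Set A}
    (hS : IsFilterBase S) {f : A → B} (hf : Monotone f) : IsFilterBase (f '' S) := by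
  refine ⟨hS.nonempty.image f, ?_⟩
  rintro _ ⟨a, ha, rfl⟩ _ ⟨b, hb, rfl⟩
  obtain ⟨c, hc, h1, h2⟩ := hS.directed a ha b hb
  exact ⟨f c, ⟨c, hc, rfl⟩, hf h1, hf h2⟩

theorem IsIdealBase.image {A B : Type*} [Preorder A] [Preorder B] {S : Set A}
    (hS : IsIdealBase S) {f : A → B} (hf : Monotone f) : IsIdealBase (f '' S) := by
  refine ⟨hS.nonempty.image f, ?_⟩
  rintro _ ⟨a, ha, rfl⟩ _ ⟨b, hb, rfl⟩
  obtain ⟨c, hc, h1, h2⟩ := hS.directed a ha b hb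
  exact ⟨f c, ⟨c, hc, rfl⟩, hf h1, hf h2⟩

theorem IsFilterBase.image2 {A B C : Type*} [Preorder A] [Preorder B] [Preorder C] {S : Set A}
    {T : Set B} (hS : IsFilterBase S) (hT : IsFilterBase T) {f : A → B → C}
    (hf : ∀ a a' b b', a ≤ a' → b ≤ b' → f a b ≤ f a' b') : IsFilterBase (Set.image2 f S T) := by
  refine ⟨hS.nonempty.image2 hT.nonempty, ?_⟩
  rintro _ ⟨a, ha, b, hb, rfl⟩ _ ⟨a', ha', b', hb', rfl⟩
  obtain ⟨c, hc, h1, h2⟩ := hS.directed a ha a' ha'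
  obtain ⟨d, hd, h3, h4⟩ := hT.directed b hb b' hb'
  exact ⟨f c d, ⟨c, hc, d, hd, rfl⟩, hf _ _ _ _ h1 h3, hf _ _ _ _ h2 h4⟩

theorem IsIdealBase.image2 {A B C : Type*} [Preorder A] [Preorder B] [Preorder C] {S : Set A}
    {T : Set B} (hS : IsIdealBase S) (hT : IsIdealBase T) {f : A → B → C}
    (hf : ∀ a a' b b', a ≤ a' → b ≤ b' → f a b ≤ f a' b') : IsIdealBase (Set.image2 f S T) := by
  refine ⟨hS.nonempty.image2 hT.nonempty, ?_⟩
  rintro _ ⟨a, ha, b, hb, rfl⟩ _ ⟨a', ha', b', hb', rfl⟩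
  obtain ⟨c, hc, h1, h2⟩ := hS.directed a ha a' ha'
  obtain ⟨d, hd, h3, h4⟩ := hT.directed b hb b' hb'
  exact ⟨f c d, ⟨c, hc, d, hd, rfl⟩, hf _ _ _ _ h1 h3, hf _ _ _ _ h2 h4⟩

namespace PrimeFilter

section

variable {A : Type*} [HeytingAlgebra A]

theorem inf_mem_iff (F : PrimeFilter A) {a b : A} : a ⊓ b ∈ F ↔ a ∈ F ∧ b ∈ F :=
  ⟨fun h => ⟨F.mem_of_le inf_le_left h, F.mem_of_le inf_le_right h⟩, fun h => F.inf_mem h.1 h.2⟩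

theorem sup_mem_iff (F : PrimeFilter A) {a b : A} : a ⊔ b ∈ F ↔ a ∈ F ∨ b ∈ F :=
  ⟨F.mem_or_mem, fun h => h.elim (F.mem_of_le le_sup_left) (F.mem_of_le le_sup_right)⟩

theorem isFilterBase (F : PrimeFilter A) : IsFilterBase (F : Set A) :=
  ⟨⟨⊤, F.top_mem⟩, fun a ha b hb => ⟨a ⊓ b, F.inf_mem ha hb, inf_le_left, inf_le_right⟩⟩

theorem isIdealBase (F : PrimeFilter A) : IsIdealBase (F : Set A)ᶜ :=
  ⟨⟨⊥, F.bot_notMem⟩, fun a ha b hb =>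
    ⟨a ⊔ b, fun h => (F.mem_or_mem h).elim ha hb, le_sup_left, le_sup_right⟩⟩

/-- The prime filter theorem. -/
theorem exists_of_disjoint {S T : Set A} (hS : IsFilterBase S) (hT : IsIdealBase T)
    (h : ∀ a ∈ S, ∀ b ∈ T, ¬ a ≤ b) :
    ∃ P : PrimeFilter A, (∀ a ∈ S, a ∈ P) ∧ ∀ b ∈ T, b ∉ P := by
  let F : Order.PFilter A := (Order.IsPFilter.of_def (F := {c | ∃ a ∈ S, a ≤ c})
    (hS.nonempty.imp fun a ha => ⟨a, ha, le_rfl⟩)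
    (fun x ⟨a, ha, hx⟩ y ⟨b, hb, hy⟩ => by
      obtain ⟨c, hc, h1, h2⟩ := hS.directed a ha b hb
      exact ⟨c, ⟨c, hc, le_rfl⟩, h1.trans hx, h2.trans hy⟩)
    (fun {x y} hxy ⟨a, ha, hx⟩ => ⟨a, ha, hx.trans hxy⟩)).toPFilter
  let I : Order.Ideal A := Order.IsIdeal.toIdeal (I := {c | ∃ a ∈ T, c ≤ a})
    ⟨fun x y hxy ⟨a, ha, hx⟩ => ⟨a, ha, hxy.trans hx⟩,
    (hT.nonempty.imp fun a ha => ⟨a, ha, le_rfl⟩),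
    (fun x ⟨a, ha, hx⟩ y ⟨b, hb, hy⟩ => by
      obtain ⟨c, hc, h1, h2⟩ := hT.directed a ha b hb
      exact ⟨c, ⟨c, hc, le_rfl⟩, hx.trans h1, hy.trans h2⟩)⟩
  have hFI : Disjoint (F : Set A) (I : Set A) := Set.disjoint_left.2 fun c hc hc' => by
    obtain ⟨a, ha, hac⟩ : ∃ a ∈ S, a ≤ c := hc
    obtain ⟨b, hb, hcb⟩ : ∃ a ∈ T, c ≤ a := hc'
    exact h a ha b hb (hac.trans hcb)
  obtain ⟨J, hJ, hIJ, hFJ⟩ := DistribLattice.prime_ideal_of_disjoint_filter_ideal hFI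
  have hTJ : ∀ b ∈ T, b ∈ J := fun b hb => hIJ (show b ∈ I from ⟨b, hb, le_rfl⟩)
  have hSJ : ∀ a ∈ S, a ∉ J := fun a ha =>
    Set.disjoint_left.1 hFJ (show a ∈ F from ⟨a, ha, le_rfl⟩)
  obtain ⟨a₀, ha₀⟩ := hS.nonempty
  -- The prime filter is the complement of the prime ideal `J`.
  refine ⟨ofSet (J : Set A)ᶜ (fun ht => hSJ a₀ ha₀ (J.lower le_top ht)) (fun hb => hb J.bot_mem)
    (fun a b hab ha hb => ha (J.lower hab hb)) (fun a b ha hb hab => ?_) (fun a b hab => ?_),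
    fun a ha => hSJ a ha, fun b hb hb' => hb' (hTJ b hb)⟩
  · exact (hJ.mem_or_mem hab).elim ha hb
  · by_contra! hc
    exact hab (Order.Ideal.sup_mem (not_not.1 hc.1) (not_not.1 hc.2))

theorem exists_of_not_le {a b : A} (h : ¬ a ≤ b) : ∃ P : PrimeFilter A, a ∈ P ∧ b ∉ P := by
  obtain ⟨P, h1, h2⟩ := exists_of_disjoint (.singleton a) (.singleton b)
    (by rintro _ rfl _ rfl; exact h)
  exact ⟨P, h1 a rfl, h2 b rfl⟩

theorem exists_mem_notMem {F G : PrimeFilter A} (h : ¬ F ≤ G) : ∃ a ∈ F, a ∉ G :=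
  Set.not_subset.1 h

/-- Prime filters of a Boolean algebra are maximal: if `a ∈ G` were missing from `F`, then `aᶜ`
would lie in `F`, hence in `G`. This makes the order on the dual of a BiBBI algebra equality. -/
theorem eq_of_le_of_boolean (hA : ∀ a : A, a ⊔ aᶜ = ⊤) {F G : PrimeFilter A} (h : F ≤ G) :
    F = G := by
  refine le_antisymm h fun a ha => ?_
  refine (F.mem_or_mem ((hA a).symm ▸ F.top_mem)).resolve_right fun hc => G.bot_notMem ?_
  rw [← inf_compl_self a]
  exact G.inf_mem ha (h hc)

/-! ### The Esakia space of prime filters -/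

theorem basic_inf (a b : A) : basic (a ⊓ b) = basic a ∩ basic b := by
  ext F; exact F.inf_mem_iff

theorem basic_sup (a b : A) : basic (a ⊔ b) = basic a ∪ basic b := by
  ext F; exact F.sup_mem_iff

theorem basic_top : basic (⊤ : A) = Set.univ := Set.eq_univ_of_forall fun F => F.top_mem

theorem basic_bot : basic (⊥ : A) = ∅ := Set.eq_empty_of_forall_notMem fun F => F.bot_notMem

instance : CompactSpace (PrimeFilter A) := by
  refine ⟨isCompact_iff_ultrafilter_le_nhds.2 fun f _ => ?_⟩
  -- The limit of the ultrafilter `f`. It is prime because an ultrafilter containing a union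
  -- contains one of the two sets, and convergence need only be checked on the subbase.
  let P : PrimeFilter A := ofSet {a | basic a ∈ f}
    (by rw [Set.mem_ofPred_eq, basic_top]; exact Filter.univ_mem) (by simp [basic_bot])
    (fun a b hab ha => Filter.mem_of_superset ha fun F hF => F.mem_of_le hab hF)
    (fun a b ha hb => by
      simp only [Set.mem_ofPred_eq, basic_inf] at *; exact Filter.inter_mem ha hb)
    (fun a b hab => by
      simp only [Set.mem_ofPred_eq, basic_sup] at *; exact Ultrafilter.union_mem_iff.1 hab)
  refine ⟨P, trivial, ?_⟩
  rw [TopologicalSpace.nhds_generateFrom]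
  refine le_iInf₂ fun s hs => ?_
  obtain ⟨hP, a, rfl | rfl⟩ := hs
  · exact Filter.le_principal_iff.2 hP
  · exact Filter.le_principal_iff.2 (Ultrafilter.compl_mem_iff_notMem.2 hP)

instance : PriestleySpace (PrimeFilter A) where
  priestley {F G} h := by
    obtain ⟨a, ha, hb⟩ := exists_mem_notMem h
    exact ⟨basic a, isClopen_basic a, fun _ _ h ha => h ha, ha, hb⟩

theorem exists_basic_subset {s : Set (PrimeFilter A)} (hs : IsOpen s) {F : PrimeFilter A}
    (hF : F ∈ s) : ∃ a b : A, F ∈ basic a \ basic b ∧ basic a \ basic b ⊆ s := by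
  induction hs with
  | basic s hs =>
    obtain ⟨a, rfl | rfl⟩ := hs
    · exact ⟨a, ⊥, ⟨hF, F.bot_notMem⟩, Set.sdiff_subset⟩
    · exact ⟨⊤, a, ⟨F.top_mem, hF⟩, fun _ h => h.2⟩
  | univ => exact ⟨⊤, ⊥, ⟨F.top_mem, F.bot_notMem⟩, Set.subset_univ _⟩
  | inter s t _ _ ihs iht =>
    obtain ⟨a, b, h1, h2⟩ := ihs hF.1
    obtain ⟨c, d, h3, h4⟩ := iht hF.2
    refine ⟨a ⊓ c, b ⊔ d, ?_, ?_⟩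
    · rw [basic_inf, basic_sup]
      exact ⟨⟨h1.1, h3.1⟩, fun h => h.elim h1.2 h3.2⟩
    · rw [basic_inf, basic_sup]
      exact fun G hG => ⟨h2 ⟨hG.1.1, fun h => hG.2 (.inl h)⟩, h4 ⟨hG.1.2, fun h => hG.2 (.inr h)⟩⟩
  | sUnion S _ ih =>
    obtain ⟨s, hs, hFs⟩ := hF
    obtain ⟨a, b, h1, h2⟩ := ih s hs hFs
    exact ⟨a, b, h1, h2.trans (Set.subset_sUnion_of_mem hs)⟩

/-- A prime filter above `F` containing `a` and omitting `b` exists unless `c ⊓ a ≤ b` for some `c ∈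
F`, which says that `a ⇨ b ∈ F`. This serves both the Esakia condition and the preservation of `⇨`
by `θ`. -/
theorem lowerClosure_basic_diff (a b : A) :
    (lowerClosure (basic a \ basic b) : Set (PrimeFilter A)) = (basic (a ⇨ b))ᶜ := by
  ext F
  simp only [SetLike.mem_coe, mem_lowerClosure]
  constructor
  · rintro ⟨G, ⟨ha, hb⟩, hFG⟩ h
    exact hb (G.mem_of_le himp_inf_le (G.inf_mem (hFG h) ha))
  · intro h
    obtain ⟨P, h1, h2⟩ := exists_of_disjoint
      (F.isFilterBase.image2 (.singleton a) (f := (· ⊓ ·)) fun _ _ _ _ => inf_le_inf)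
      (.singleton b) (by
        rintro _ ⟨c, hc, _, rfl, rfl⟩ _ rfl hle
        exact h (F.mem_of_le (le_himp_iff.2 hle) hc))
    refine ⟨P, ⟨?_, h2 b rfl⟩, fun c hc => ?_⟩
    · exact P.mem_of_le inf_le_right (h1 (⊤ ⊓ a) ⟨⊤, F.top_mem, a, rfl, rfl⟩)
    · exact P.mem_of_le inf_le_left (h1 (c ⊓ a) ⟨c, hc, a, rfl, rfl⟩)

instance : EsakiaSpace (PrimeFilter A) where
  isClopen_lowerClosure C hC := by
    obtain ⟨D, h1, h2, h3⟩ : ∃ D, C ⊆ D ∧ D ⊆ C ∧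
        IsClopen (lowerClosure D : Set (PrimeFilter A)) := by
      -- By compactness `C` is a finite union of differences of basic sets, and lower closure
      -- commutes with unions. The property carried through asks for a set `D` between `S` and `C`;
      -- at `S = C` it forces `D = C`.
      refine hC.isClosed.isCompact.induction_on
        (p := fun S => ∃ D, S ⊆ D ∧ D ⊆ C ∧ IsClopen (lowerClosure D : Set (PrimeFilter A)))
        ⟨∅, subset_rfl, Set.empty_subset _, by simp [isClopen_empty]⟩
        (fun s t hst ⟨D, h1, h2⟩ => ⟨D, hst.trans h1, h2⟩) ?_ ?_
      · rintro s t ⟨D, h1, h2, h3⟩ ⟨D', h1', h2', h3'⟩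
        refine ⟨D ∪ D', Set.union_subset_union h1 h1', Set.union_subset h2 h2', ?_⟩
        rw [lowerClosure_union]
        exact h3.union h3'
      · intro F hF
        obtain ⟨a, b, h1, h2⟩ := exists_basic_subset hC.isOpen hF
        refine ⟨basic a \ basic b, mem_nhdsWithin_of_mem_nhds
          (((isClopen_basic a).diff (isClopen_basic b)).isOpen.mem_nhds h1),
          _, subset_rfl, h2, ?_⟩
        rw [lowerClosure_basic_diff]
        exact (isClopen_basic _).compl
    rwa [h1.antisymm h2]

/-! ### Bijectivity of `θ` -/

theorem theta_injective : Function.Injective (theta (A := A)) := by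
  intro a b h
  have key : ∀ F : PrimeFilter A, a ∈ F ↔ b ∈ F := fun F =>
    Set.ext_iff.1 (congrArg (fun C : ClopenUpperSet (PrimeFilter A) => (C : Set _)) h) F
  refine le_antisymm ?_ ?_ <;> by_contra hle
  · obtain ⟨P, h1, h2⟩ := exists_of_not_le hle
    exact h2 ((key P).1 h1)
  · obtain ⟨P, h1, h2⟩ := exists_of_not_le hle
    exact h2 ((key P).2 h1)

theorem theta_surjective : Function.Surjective (theta (A := A)) := by
  intro C
  have hcl : IsClopen (C : Set (PrimeFilter A)) := C.isClopen
  -- Compactness is used twice. Here, for a fixed `F ∈ C`, every `G ∉ C` omits some element of `F`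
  -- since `C` is an up-set, and finitely many of these elements suffice; their meet is `a`.
  -- Afterwards the sets `basic a` cover `C`, and a finite join gives the required element.
  have key : ∀ F ∈ (C : Set (PrimeFilter A)), ∃ a ∈ F, basic a ⊆ (C : Set (PrimeFilter A)) := by
    intro F hF
    obtain ⟨a, ha, h⟩ : ∃ a ∈ F, Disjoint (C : Set (PrimeFilter A))ᶜ (basic a) := by
      refine hcl.compl.isClosed.isCompact.induction_on (p := fun S => ∃ a ∈ F, Disjoint S (basic a))
        ⟨⊤, F.top_mem, Set.empty_disjoint _⟩
        (fun s t hst ⟨a, ha, h⟩ => ⟨a, ha, h.mono_left hst⟩) ?_ ?_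
      · rintro s t ⟨a, ha, h⟩ ⟨b, hb, h'⟩
        refine ⟨a ⊓ b, F.inf_mem ha hb, ?_⟩
        rw [basic_inf]
        exact Set.disjoint_union_left.2
          ⟨h.mono_right Set.inter_subset_left, h'.mono_right Set.inter_subset_right⟩
      · intro G hG
        obtain ⟨a, ha, hb⟩ := exists_mem_notMem fun hle : F ≤ G => hG (C.upper hle hF)
        exact ⟨(basic a)ᶜ, mem_nhdsWithin_of_mem_nhds
          ((isClopen_basic a).compl.isOpen.mem_nhds hb), a, ha, disjoint_compl_left⟩
    exact ⟨a, ha, fun G hG => by_contra fun hGC => Set.disjoint_left.1 h hGC hG⟩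
  obtain ⟨a, h1, h2⟩ : ∃ a : A, (C : Set (PrimeFilter A)) ⊆ basic a ∧
      basic a ⊆ (C : Set (PrimeFilter A)) := by
    refine hcl.isClosed.isCompact.induction_on
      (p := fun S => ∃ a : A, S ⊆ basic a ∧ basic a ⊆ (C : Set (PrimeFilter A)))
      ⟨⊥, Set.empty_subset _, by rw [basic_bot]; exact Set.empty_subset _⟩
      (fun s t hst ⟨a, h1, h2⟩ => ⟨a, hst.trans h1, h2⟩) ?_ ?_
    · rintro s t ⟨a, h1, h2⟩ ⟨b, h3, h4⟩
      refine ⟨a ⊔ b, ?_⟩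
      rw [basic_sup]
      exact ⟨Set.union_subset_union h1 h3, Set.union_subset h2 h4⟩
    · intro F hF
      obtain ⟨a, ha, h⟩ := key F hF
      exact ⟨basic a, mem_nhdsWithin_of_mem_nhds ((isClopen_basic a).isOpen.mem_nhds ha),
        a, subset_rfl, h⟩
  exact ⟨a, SetLike.coe_injective (h2.antisymm h1)⟩

end

end PrimeFilter

/-! ### Points of an Esakia space as prime filters -/

namespace ClopenUpperSet

variable {X : Type*} [TopologicalSpace X] [PartialOrder X] [EsakiaSpace X]

theorem eta_le_eta {x y : X} : eta x ≤ eta y ↔ x ≤ y := by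
  refine ⟨fun h => ?_, fun h C hx => C.upper h hx⟩
  by_contra hxy
  obtain ⟨C, h1, h2, h3, h4⟩ := exists_isClopen_upper_of_not_le hxy
  exact h4 (h (show (⟨⟨C, h1⟩, h2⟩ : ClopenUpperSet X) ∈ eta x from h3))

theorem eta_injective : Function.Injective (eta (X := X)) := fun _ _ h =>
  le_antisymm (eta_le_eta.1 h.le) (eta_le_eta.1 h.ge)

theorem eta_surjective : Function.Surjective (eta (X := X)) := by
  intro P
  by_contra! hP
  -- If `P` is no `η x`, each point disagrees with `P` about some clopen up-set. Near the point this
  -- gives a local inclusion of a member of `P` in a non-member, with `⊤` or `⊥` as the other set.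
  -- Compactness glues these into a global inclusion, which contradicts upward closure of `P`.
  have key : ∃ C ∈ P, ∃ D ∉ P, Set.univ ∩ (C : Set X) ⊆ (D : Set X) := by
    refine isCompact_univ.induction_on
      (p := fun S => ∃ C ∈ P, ∃ D ∉ P, S ∩ (C : Set X) ⊆ (D : Set X))
      ⟨⊤, P.top_mem, ⊥, P.bot_notMem, by simp⟩
      (fun s t hst ⟨C, hC, D, hD, h⟩ =>
        ⟨C, hC, D, hD, (Set.inter_subset_inter_left _ hst).trans h⟩) ?_ ?_
    · rintro s t ⟨C, hC, D, hD, h⟩ ⟨C', hC', D', hD', h'⟩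
      refine ⟨C ⊓ C', P.inf_mem hC hC', D ⊔ D', fun hmem => (P.mem_or_mem hmem).elim hD hD', ?_⟩
      rintro x ⟨hx | hx, hxC, hxC'⟩
      · exact Or.inl (h ⟨hx, hxC⟩)
      · exact Or.inr (h' ⟨hx, hxC'⟩)
    · intro x _
      obtain ⟨C, hC⟩ : ∃ C : ClopenUpperSet X, ¬ (x ∈ C ↔ C ∈ P) := by
        by_contra! hc
        exact hP x (SetLike.ext fun C => hc C)
      by_cases hx : x ∈ C
      · exact ⟨C, mem_nhdsWithin_of_mem_nhds (C.isClopen.isOpen.mem_nhds hx), ⊤, P.top_mem, C,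
          fun h => hC ⟨fun _ => h, fun _ => hx⟩, Set.inter_subset_left⟩
      · refine ⟨(C : Set X)ᶜ, mem_nhdsWithin_of_mem_nhds (C.isClopen.compl.isOpen.mem_nhds hx), C,
          by_contra fun h => hC ⟨fun h' => absurd h' hx, fun h' => absurd h' h⟩, ⊥, P.bot_notMem,
          fun y hy => absurd hy.2 hy.1⟩
  obtain ⟨C, hC, D, hD, h⟩ := key
  exact hD (P.mem_of_le (show C ≤ D from fun x hx => h ⟨trivial, hx⟩) hC)

theorem continuous_eta : Continuous (eta (X := X)) := by
  refine continuous_generateFrom_iff.2 ?_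
  rintro _ ⟨C, rfl | rfl⟩
  · exact C.isClopen.isOpen
  · exact C.isClopen.compl.isOpen

/-- `η` as a homeomorphism. -/
noncomputable def etaHomeomorph : X ≃ₜ PrimeFilter (ClopenUpperSet X) :=
  continuous_eta.homeoOfEquivCompactToT2 (f := Equiv.ofBijective eta ⟨eta_injective, eta_surjective⟩)

end ClopenUpperSet

/-! ### Monotonicity and distributivity in basic BiBI algebras -/

namespace IsBasicBiBIAlgebra

variable {A : Type*} [HeytingAlgebra A] [BiOps A] (h : IsBasicBiBIAlgebra A)
include h

theorem star_mono {a a' b b' : A} (ha : a ≤ a') (hb : b ≤ b') :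
    BiOps.star a b ≤ BiOps.star a' b' :=
  ((h.le_wand_iff _ _ _).2 (ha.trans ((h.le_wand_iff a' b _).1 le_rfl))).trans
    ((h.le_wand_iff' _ _ _).2 (hb.trans ((h.le_wand_iff' a' b' _).1 le_rfl)))

/-- `star a` is left adjoint to `wand a`, so it preserves finite joins; `star_bot` is the empty
case. -/
theorem star_sup (a b c : A) : BiOps.star a (b ⊔ c) ≤ BiOps.star a b ⊔ BiOps.star a c :=
  (h.le_wand_iff' _ _ _).2 (sup_le ((h.le_wand_iff' _ _ _).1 le_sup_left)
    ((h.le_wand_iff' _ _ _).1 le_sup_right))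

theorem star_bot (a : A) : BiOps.star a ⊥ = ⊥ :=
  le_bot_iff.1 ((h.le_wand_iff' _ _ _).2 bot_le)

theorem star_wand (a b : A) : BiOps.star (wand a b) a ≤ b := (h.le_wand_iff _ _ _).2 le_rfl

theorem le_par_rslash (a b : A) : a ≤ par b (rslash a b) := (h.rslash_le_iff _ _ _).2 le_rfl

theorem par_mono_right {a b b' : A} (hb : b ≤ b') : par a b ≤ par a b' :=
  (h.rslash_le_iff _ _ _).2 (((h.rslash_le_iff _ a b).1 le_rfl).trans hb)

theorem par_mono {a a' b b' : A} (ha : a ≤ a') (hb : b ≤ b') : par a b ≤ par a' b' := by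
  refine (h.par_mono_right hb).trans ?_
  rw [h.par_comm a, h.par_comm a']
  exact h.par_mono_right ha

/-- `par a` is right adjoint to `rslash · a`, so it preserves finite meets; `par_top` is the empty
case. -/
theorem le_par_inf (a b c : A) : par a b ⊓ par a c ≤ par a (b ⊓ c) :=
  (h.rslash_le_iff _ _ _).2 (le_inf ((h.rslash_le_iff _ _ _).1 inf_le_left)
    ((h.rslash_le_iff _ _ _).1 inf_le_right))

theorem par_top (a : A) : par a ⊤ = ⊤ := top_le_iff.1 ((h.rslash_le_iff _ _ _).2 le_top)

end IsBasicBiBIAlgebra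

/-! ### Extension of bases to prime filters related by `∘` and `▽` -/

namespace PrimeFilter

section

variable {A : Type*} [HeytingAlgebra A] [BiOps A] (h : IsBasicBiBIAlgebra A)
include h

/-- The elements `d` with `a * d ∉ w` for some `a ∈ F` form an ideal. -/
theorem isIdealBase_star {F : Set A} (hF : IsFilterBase F) (w : PrimeFilter A) :
    IsIdealBase {d | ∃ a ∈ F, BiOps.star a d ∉ w} := by
  constructor
  · obtain ⟨a, ha⟩ := hF.nonempty
    exact ⟨⊥, a, ha, by rw [h.star_bot]; exact w.bot_notMem⟩
  · rintro d ⟨a, ha, hd⟩ d' ⟨a', ha', hd'⟩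
    obtain ⟨c, hc, h1, h2⟩ := hF.directed a ha a' ha'
    refine ⟨d ⊔ d', ⟨c, hc, fun hw => ?_⟩, le_sup_left, le_sup_right⟩
    rcases w.mem_or_mem (w.mem_of_le (h.star_sup _ _ _) hw) with hw | hw
    · exact hd (w.mem_of_le (h.star_mono h1 le_rfl) hw)
    · exact hd' (w.mem_of_le (h.star_mono h2 le_rfl) hw)

/-- The elements `d` with `a ⅋ d ∈ w` for some `a ∈ I` form a filter. -/
theorem isFilterBase_par {I : Set A} (hI : IsIdealBase I) (w : PrimeFilter A) :
    IsFilterBase {d | ∃ a ∈ I, par a d ∈ w} := by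
  constructor
  · obtain ⟨a, ha⟩ := hI.nonempty
    exact ⟨⊤, a, ha, by rw [h.par_top]; exact w.top_mem⟩
  · rintro d ⟨a, ha, hd⟩ d' ⟨a', ha', hd'⟩
    obtain ⟨c, hc, h1, h2⟩ := hI.directed a ha a' ha'
    refine ⟨d ⊓ d', ⟨c, hc, ?_⟩, inf_le_left, inf_le_right⟩
    exact w.mem_of_le (h.le_par_inf _ _ _) (w.inf_mem
      (w.mem_of_le (h.par_mono h1 le_rfl) hd) (w.mem_of_le (h.par_mono h2 le_rfl) hd'))

/-- Separate `G` from the ideal of elements `d` with `a * d ∉ w` for some `a ∈ F`. The set `F` need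
not be prime, which lets `exists_mem_comp` apply this twice, once per factor. -/
theorem exists_star_right {F G : Set A} (hF : IsFilterBase F) (hG : IsFilterBase G)
    (w : PrimeFilter A) (hw : ∀ a ∈ F, ∀ b ∈ G, BiOps.star a b ∈ w) :
    ∃ P : PrimeFilter A, (∀ b ∈ G, b ∈ P) ∧ ∀ a ∈ F, ∀ b ∈ P, BiOps.star a b ∈ w := by
  obtain ⟨P, h1, h2⟩ := exists_of_disjoint hG (isIdealBase_star h hF w) (by
    rintro b hb d ⟨a, ha, hd⟩ hle
    exact hd (w.mem_of_le (h.star_mono le_rfl hle) (hw a ha b hb)))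
  exact ⟨P, h1, fun a ha b hb => by_contra fun hn => h2 b ⟨a, ha, hn⟩ hb⟩

theorem exists_mem_comp {F G : Set A} (hF : IsFilterBase F) (hG : IsFilterBase G)
    (w : PrimeFilter A) (hw : ∀ a ∈ F, ∀ b ∈ G, BiOps.star a b ∈ w) :
    ∃ P Q : PrimeFilter A, (∀ a ∈ F, a ∈ P) ∧ (∀ b ∈ G, b ∈ Q) ∧ w ∈ BiFrameStr.comp P Q := by
  obtain ⟨Q, h1, h2⟩ := exists_star_right h hF hG w hw
  obtain ⟨P, h3, h4⟩ := exists_star_right h Q.isFilterBase hF w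
    fun b hb a ha => by rw [h.star_comm]; exact h2 a ha b hb
  exact ⟨P, Q, h3, h1, fun a ha b hb => by rw [h.star_comm]; exact h4 b hb a ha⟩

/-- The order dual of `exists_star_right`: the given data are ideals to be avoided, and the filter
of elements `d` with `a ⅋ d ∈ w` for some `a ∈ I` is separated from `J`. -/
theorem exists_par_right {I J : Set A} (hI : IsIdealBase I) (hJ : IsIdealBase J)
    (w : PrimeFilter A) (hw : ∀ a ∈ I, ∀ b ∈ J, par a b ∉ w) :
    ∃ P : PrimeFilter A, (∀ b ∈ J, b ∉ P) ∧ ∀ a ∈ I, ∀ b, par a b ∈ w → b ∈ P := by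
  obtain ⟨P, h1, h2⟩ := exists_of_disjoint (isFilterBase_par h hI w) hJ (by
    rintro d ⟨a, ha, hd⟩ b hb hle
    exact hw a ha b hb (w.mem_of_le (h.par_mono le_rfl hle) hd))
  exact ⟨P, h2, fun a ha b hb => h1 b ⟨a, ha, hb⟩⟩

/-- The second half of the extension, with one factor `u` already prime: its complement is an ideal
base, and commutativity of `⅋` exchanges the two sides. -/
theorem exists_par_left {J : Set A} (hJ : IsIdealBase J) (w u : PrimeFilter A)
    (hw : ∀ b ∈ J, ∀ c, par b c ∈ w → c ∈ u) :
    ∃ t : PrimeFilter A, (∀ b ∈ J, b ∉ t) ∧ w ∈ cocomp t u := by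
  obtain ⟨t, h1, h2⟩ := exists_par_right h u.isIdealBase hJ w
    fun a ha b hb hab => ha (hw b hb a (by rwa [h.par_comm]))
  exact ⟨t, h1, fun a b hab => or_iff_not_imp_right.2 fun hb =>
    h2 b hb a (by rwa [h.par_comm])⟩

theorem exists_mem_cocomp {I J : Set A} (hI : IsIdealBase I) (hJ : IsIdealBase J)
    (w : PrimeFilter A) (hw : ∀ a ∈ I, ∀ b ∈ J, par a b ∉ w) :
    ∃ t u : PrimeFilter A, (∀ a ∈ I, a ∉ t) ∧ (∀ b ∈ J, b ∉ u) ∧ w ∈ cocomp t u := by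
  obtain ⟨u, h1, h2⟩ := exists_par_right h hI hJ w hw
  obtain ⟨t, h3, h4⟩ := exists_par_left h hI w u h2
  exact ⟨t, u, h3, h1, h4⟩

theorem mem_comp_comm {x y z : PrimeFilter A} (hz : z ∈ BiFrameStr.comp x y) :
    z ∈ BiFrameStr.comp y x :=
  fun a ha b hb => by rw [h.star_comm]; exact hz b hb a ha

theorem mem_cocomp_comm {x y z : PrimeFilter A} (hz : z ∈ cocomp x y) : z ∈ cocomp y x :=
  fun a b hab => (hz b a (by rwa [h.par_comm])).symm

/-- The canonical existence property underlying the wand: if `x` and `F` compose outside of the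
ideal `T`, the composition is witnessed by prime filters. -/
theorem exists_comp_of_disjoint (x : PrimeFilter A) {F T : Set A} (hF : IsFilterBase F)
    (hT : IsIdealBase T) (hd : ∀ a ∈ x, ∀ b ∈ F, ∀ c ∈ T, ¬ BiOps.star a b ≤ c) :
    ∃ y z : PrimeFilter A, z ∈ BiFrameStr.comp x y ∧ (∀ b ∈ F, b ∈ y) ∧ ∀ c ∈ T, c ∉ z := by
  obtain ⟨z, h1, h2⟩ := exists_of_disjoint
    (x.isFilterBase.image2 hF (f := BiOps.star) fun _ _ _ _ => h.star_mono) hT (by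
      rintro _ ⟨a, ha, b, hb, rfl⟩ c hc
      exact hd a ha b hb c hc)
  obtain ⟨y, h3, h4⟩ := exists_star_right h x.isFilterBase hF z
    fun a ha b hb => h1 _ ⟨a, ha, b, hb, rfl⟩
  exact ⟨y, z, h4, h3, h2⟩

/-- The canonical existence property underlying the residual of `⅋`. -/
theorem exists_cocomp_of_disjoint (s : PrimeFilter A) {F T : Set A} (hF : IsFilterBase F)
    (hT : IsIdealBase T) (hd : ∀ a ∈ F, ∀ b ∈ T, ∀ c ∉ s, ¬ a ≤ par b c) :
    ∃ t u : PrimeFilter A, u ∈ cocomp t s ∧ (∀ a ∈ F, a ∈ u) ∧ ∀ b ∈ T, b ∉ t := by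
  obtain ⟨u, h1, h2⟩ := exists_of_disjoint hF
    (hT.image2 s.isIdealBase (f := par) fun _ _ _ _ => h.par_mono) (by
      rintro a ha _ ⟨b, hb, c, hc, rfl⟩
      exact hd a ha b hb c hc)
  obtain ⟨t, h3, h4⟩ := exists_par_left h hT u s
    fun b hb c hbc => by_contra fun hc => h2 _ ⟨b, hb, c, hc, rfl⟩ hbc
  exact ⟨t, u, h4, h1, h3⟩

/-! ### Complex operations on basic sets -/

/-- As for the other complex operations below, one inclusion unfolds the canonical relation, and the
other extends the singletons `{a}` and `{b}` to prime filters. -/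
theorem cStar_basic (a b : A) : cStar (basic a) (basic b) = basic (BiOps.star a b) := by
  ext x
  constructor
  · rintro ⟨w, y, z, hw, hwyz, hy, hz⟩
    exact hw (hwyz a hy b hz)
  · intro hx
    obtain ⟨P, Q, h1, h2, h3⟩ := exists_mem_comp h (.singleton a) (.singleton b) x
      (by rintro _ rfl _ rfl; exact hx)
    exact ⟨x, P, Q, le_rfl, h3, h1 a rfl, h2 b rfl⟩

theorem cWand_basic (a b : A) : cWand (basic a) (basic b) = basic (wand a b) := by
  ext x
  constructor
  · intro hx
    by_contra hn
    obtain ⟨y, z, h1, h2, h3⟩ := exists_comp_of_disjoint h x (.singleton a) (.singleton b) (by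
      rintro c hc _ rfl _ rfl hle
      exact hn (x.mem_of_le ((h.le_wand_iff _ _ _).1 hle) hc))
    exact h3 b rfl (hx x y z le_rfl h1 (h2 a rfl))
  · intro hx w y z hw hz hy
    exact z.mem_of_le (h.star_wand a b) (hz _ (hw hx) a hy)

theorem cDnaw_basic (a b : A) : cDnaw (basic a) (basic b) = basic (wand a b) := by
  rw [← cWand_basic h]
  ext x
  exact ⟨fun hx w y z hw hz => hx w y z hw (mem_comp_comm h hz),
    fun hx w y z hw hz => hx w y z hw (mem_comp_comm h hz)⟩

theorem cPar_basic (a b : A) : cPar (basic a) (basic b) = basic (par a b) := by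
  ext x
  constructor
  · intro hx
    by_contra hn
    obtain ⟨t, u, h1, h2, h3⟩ := exists_mem_cocomp h (.singleton a) (.singleton b) x
      (by rintro _ rfl _ rfl; exact hn)
    exact (hx x t u le_rfl h3).elim (h1 a rfl) (h2 b rfl)
  · intro hx s t u hs hstu
    exact hstu a b (hs hx)

theorem cRslash_basic (a b : A) : cRslash (basic a) (basic b) = basic (rslash a b) := by
  ext x
  constructor
  · rintro ⟨s, t, u, hs, hu, ha, hb⟩
    exact hs ((hu b _ (u.mem_of_le (h.le_par_rslash a b) ha)).resolve_left hb)
  · intro hx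
    obtain ⟨t, u, h1, h2, h3⟩ := exists_cocomp_of_disjoint h x (.singleton a) (.singleton b) (by
      rintro _ rfl _ rfl c hc hle
      exact hc (x.mem_of_le ((h.rslash_le_iff _ _ _).1 hle) hx))
    exact ⟨x, t, u, le_rfl, h1, h2 a rfl, h3 b rfl⟩

/-! ### Frame conditions on the prime filter space -/

theorem basicBiBIFrame : BasicBiBIFrame (PrimeFilter A) where
  comp_comm _ _ _ := mem_comp_comm h
  E_upper _ _ he hle := hle he
  unit_exists x := by
    obtain ⟨e, h1, h2⟩ := exists_star_right h x.isFilterBase (.singleton mtop) x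
      (by rintro a ha _ rfl; rwa [h.star_mtop])
    exact ⟨e, h1 _ rfl, h2⟩
  coherence x y e he hx a ha := by
    have := hx a ha mtop he
    rwa [h.star_mtop] at this
  comp_assoc x y z t t' w htt' ht hw := by
    -- The set of products of `y` and `z` is a filter base whose products with `x` lie in `w` by
    -- associativity of `*`. A prime extension `s` then satisfies the condition with `s' = s` and
    -- `w' = w`.
    obtain ⟨s, h1, h2⟩ := exists_star_right h x.isFilterBase
      (y.isFilterBase.image2 z.isFilterBase (f := BiOps.star) fun _ _ _ _ => h.star_mono) w (by
        rintro a ha _ ⟨b, hb, c, hc, rfl⟩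
        rw [← h.star_assoc]
        exact hw _ (htt' (ht a ha b hb)) c hc)
    exact ⟨s, s, w, le_rfl, fun b hb c hc => h1 _ ⟨b, hb, c, hc, rfl⟩, le_rfl, h2⟩
  cocomp_comm _ _ _ := mem_cocomp_comm h
  U_lower _ _ hu hle hu' := hu (hle hu')

/-- Surjectivity of `θ` makes every clopen up-set basic, so closure under the complex operations
follows from their values on basic sets. A failure of the canonical relation is itself a pair of
separating elements. -/
theorem basicBiBISpace : BasicBiBISpace (PrimeFilter A) :=
  { basicBiBIFrame h with
    toEsakiaSpace := inferInstance
    isClopen_cStar := fun C D => by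
      obtain ⟨a, rfl⟩ := theta_surjective C
      obtain ⟨b, rfl⟩ := theta_surjective D
      exact (cStar_basic h a b).symm ▸ isClopen_basic _
    isClopen_cWand := fun C D => by
      obtain ⟨a, rfl⟩ := theta_surjective C
      obtain ⟨b, rfl⟩ := theta_surjective D
      exact (cWand_basic h a b).symm ▸ isClopen_basic _
    isClopen_cDnaw := fun C D => by
      obtain ⟨a, rfl⟩ := theta_surjective C
      obtain ⟨b, rfl⟩ := theta_surjective D
      exact (cDnaw_basic h a b).symm ▸ isClopen_basic _
    isClopen_cPar := fun C D => by
      obtain ⟨a, rfl⟩ := theta_surjective C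
      obtain ⟨b, rfl⟩ := theta_surjective D
      exact (cPar_basic h a b).symm ▸ isClopen_basic _
    isClopen_cRslash := fun C D => by
      obtain ⟨a, rfl⟩ := theta_surjective C
      obtain ⟨b, rfl⟩ := theta_surjective D
      exact (cRslash_basic h a b).symm ▸ isClopen_basic _
    isClopen_E := isClopen_basic mtop
    isClopen_U := (isClopen_basic mbot).compl
    comp_separation := fun x y z hx => by
      obtain ⟨a, ha, b, hb, hab⟩ : ∃ a ∈ y, ∃ b ∈ z, BiOps.star a b ∉ x := by
        by_contra! hc
        exact hx hc
      exact ⟨theta a, theta b, ha, hb, fun hx' => hab ((cStar_basic h a b).subset hx')⟩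
    cocomp_separation := fun x y z hx => by
      obtain ⟨a, b, hab, ha, hb⟩ : ∃ a b, par a b ∈ x ∧ a ∉ y ∧ b ∉ z := by
        by_contra! hc
        exact hx fun a b hab => or_iff_not_imp_left.2 fun ha => hc a b hab ha
      exact ⟨theta a, theta b, ha, hb, (cPar_basic h a b).superset hab⟩ }

theorem frameHolds {σ : SubclassicalAxiom} (hσ : σ.HoldsIn A) : σ.FrameHolds (PrimeFilter A) := by
  cases σ with
  | associativity =>
    intro x y z t t' w htt' ht hw
    obtain ⟨s, h1, h2⟩ := exists_par_right h x.isIdealBase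
      (y.isIdealBase.image2 z.isIdealBase (f := par) fun _ _ _ _ => h.par_mono) w (by
        rintro a ha _ ⟨b, hb, c, hc, rfl⟩ hmem
        rcases hw _ _ (w.mem_of_le (hσ a b c) hmem) with hab | hc'
        · exact (ht a b (htt' hab)).elim ha hb
        · exact hc hc')
    refine ⟨s, s, w, le_rfl, fun b c hbc => ?_, le_rfl,
      fun a b hab => or_iff_not_imp_left.2 fun ha => h2 a ha b hab⟩
    by_contra! hc
    exact h1 _ ⟨b, hc.1, c, hc.2, rfl⟩ hbc
  | mbotWeakening =>
    intro x y u hu hx a ha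
    exact (hx _ _ (x.mem_of_le (hσ a) ha)).resolve_right hu
  | mbotContraction =>
    intro w
    obtain ⟨u, h1, h2⟩ := exists_par_right h w.isIdealBase (.singleton mbot) w (by
      rintro a ha _ rfl hmem
      exact ha (w.mem_of_le (hσ a) hmem))
    exact ⟨u, h1 _ rfl, fun a b hab => or_iff_not_imp_left.2 fun ha => h2 a ha b hab⟩
  | parContraction =>
    intro x a b hab
    exact x.mem_or_mem (x.mem_of_le (hσ _) (x.mem_of_le (h.par_mono le_sup_left le_sup_right) hab))
  | weakDistributivity =>
    intro x₁ x₂ y₁ y₂ t t' t'' htt' ht ht'' hy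
    -- The two required relations prescribe which elements `w` must contain and which it must omit.
    -- Weak distributivity makes these compatible: `a * (d ⅋ c) ∈ t''` gives `(a * d) ⅋ c ∈ t''`,
    -- hence `a * d ∈ y₁` or `c ∈ y₂`.
    obtain ⟨w, h1, h2⟩ := exists_of_disjoint (isFilterBase_par h y₂.isIdealBase x₂)
      (isIdealBase_star h x₁.isFilterBase y₁) (by
        rintro d ⟨c, hc, hd⟩ d' ⟨a, ha, hd'⟩ hle
        rw [h.par_comm] at hd
        rcases hy _ _ (t''.mem_of_le (hσ a d c) (ht'' (htt' (ht a ha _ hd)))) with hm | hm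
        · exact hd' (y₁.mem_of_le (h.star_mono le_rfl hle) hm)
        · exact hc hm)
    refine ⟨w, fun a ha d hd => by_contra fun hn => h2 d ⟨a, ha, hn⟩ hd,
      fun d c hdc => or_iff_not_imp_right.2 fun hc => h1 d ⟨c, hc, ?_⟩⟩
    rwa [h.par_comm]

end

theorem isBiSpace {v : BiVariant} {Ax : Set SubclassicalAxiom} {A : Type*} [HeytingAlgebra A]
    [BiOps A] (h : IsBiAlgebra v Ax A) : IsBiSpace v Ax (PrimeFilter A) where
  toBasicBiBISpace := basicBiBISpace h.toIsBasicBiBIAlgebra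
  discrete hv _ _ hle := eq_of_le_of_boolean (h.boolean hv) hle
  holds σ hσ := frameHolds h.toIsBasicBiBIAlgebra (h.holds σ hσ)

/-! ### Inverse images of prime filters -/

theorem isBiSpaceHom_comap {A B : Type*} [HeytingAlgebra A] [BiOps A] [HeytingAlgebra B] [BiOps B]
    (hB : IsBasicBiBIAlgebra B) (hA : IsBasicBiBIAlgebra A) {f : A → B} (hf : IsBiAlgHom f) :
    IsBiSpaceHom (comap f hf.map_inf hf.map_sup hf.map_top hf.map_bot) := by
  have hmono : Monotone f := fun a b hab => by
    rw [← inf_eq_left, ← hf.map_inf, inf_eq_left.2 hab]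
  -- The bound `a * f b ≤ f c` becomes `a ≤ f (b -* c)` because `f` preserves the wand, so
  -- membership is transported to `w'`. By commutativity the same claim also yields the mirrored
  -- condition for `•-`.
  have wandBack : ∀ (x : PrimeFilter B) (w' y' z' : PrimeFilter A),
      comap f hf.map_inf hf.map_sup hf.map_top hf.map_bot x ≤ w' → z' ∈ BiFrameStr.comp w' y' →
      ∃ w y z, x ≤ w ∧ z ∈ BiFrameStr.comp w y ∧
        y' ≤ comap f hf.map_inf hf.map_sup hf.map_top hf.map_bot y ∧
        comap f hf.map_inf hf.map_sup hf.map_top hf.map_bot z ≤ z' := by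
    intro x w' y' z' hx hz'
    obtain ⟨y, z, h1, h2, h3⟩ := exists_comp_of_disjoint hB x (y'.isFilterBase.image hmono)
      (z'.isIdealBase.image hmono) (by
        rintro a ha _ ⟨b, hb, rfl⟩ _ ⟨c, hc, rfl⟩ hle
        rw [hB.le_wand_iff, ← hf.map_wand] at hle
        exact hc (z'.mem_of_le (hA.star_wand b c) (hz' _ (hx (x.mem_of_le hle ha)) b hb)))
    exact ⟨x, y, z, le_rfl, h1, fun b hb => h2 _ ⟨b, hb, rfl⟩,
      fun c hc => by_contra fun hn => h3 _ ⟨c, hn, rfl⟩ hc⟩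
  constructor
  · refine continuous_generateFrom_iff.2 ?_
    rintro _ ⟨a, rfl | rfl⟩
    · exact (isClopen_basic (f a)).isOpen
    · exact (isClopen_basic (f a)).compl.isOpen
  · exact fun x y hxy a ha => hxy ha
  · intro x y' hx
    -- Equality `f⁻¹ y = y'` is needed, so `y` must contain the image of `y'` and omit the image of
    -- its complement, while extending `x`. Preservation of `⇨` makes these demands compatible.
    obtain ⟨y, h1, h2⟩ := exists_of_disjoint
      (x.isFilterBase.image2 (y'.isFilterBase.image hmono) (f := (· ⊓ ·))
        fun _ _ _ _ => inf_le_inf) (y'.isIdealBase.image hmono) (by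
        rintro _ ⟨c, hc, _, ⟨a, ha, rfl⟩, rfl⟩ _ ⟨b, hb, rfl⟩ hle
        rw [← le_himp_iff, ← hf.map_himp] at hle
        exact hb (y'.mem_of_le himp_inf_le (y'.inf_mem (hx (x.mem_of_le hle hc)) ha)))
    refine ⟨y, fun c hc => ?_, le_antisymm (fun a ha => ?_) fun a ha => ?_⟩
    · exact y.mem_of_le inf_le_left (h1 _ ⟨c, hc, f ⊤, ⟨⊤, y'.top_mem, rfl⟩, rfl⟩)
    · exact by_contra fun hn => h2 _ ⟨a, hn, rfl⟩ ha
    · exact y.mem_of_le inf_le_right (h1 _ ⟨⊤, x.top_mem, f a, ⟨a, ha, rfl⟩, rfl⟩)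
  · intro x y z hx a ha b hb
    change f (BiOps.star a b) ∈ x
    rw [hf.map_star]
    exact hx _ ha _ hb
  · intro x w' y' z' hw hw'
    obtain ⟨y, z, h1, h2, h3⟩ := exists_mem_comp hB (y'.isFilterBase.image hmono)
      (z'.isFilterBase.image hmono) x (by
        rintro _ ⟨a, ha, rfl⟩ _ ⟨b, hb, rfl⟩
        rw [← hf.map_star]
        exact hw (hw' a ha b hb))
    exact ⟨x, y, z, le_rfl, h3, fun a ha => h1 _ ⟨a, ha, rfl⟩, fun a ha => h2 _ ⟨a, ha, rfl⟩⟩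
  · exact wandBack
  · intro x w' y' z' hx hz
    obtain ⟨w, y, z, h1, h2, h3⟩ := wandBack x w' y' z' hx (mem_comp_comm hA hz)
    exact ⟨w, y, z, h1, mem_comp_comm hB h2, h3⟩
  · intro e
    change _ ↔ f mtop ∈ e
    rw [hf.map_mtop]
    rfl
  · intro x y z hx a b hab
    change f (par a b) ∈ x at hab
    rw [hf.map_par] at hab
    exact hx _ _ hab
  · intro x s' t' u' hx hs
    obtain ⟨t, u, h1, h2, h3⟩ := exists_mem_cocomp hB (t'.isIdealBase.image hmono)
      (u'.isIdealBase.image hmono) x (by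
        rintro _ ⟨a, ha, rfl⟩ _ ⟨b, hb, rfl⟩ hmem
        rw [← hf.map_par] at hmem
        exact (hs a b (hx hmem)).elim ha hb)
    exact ⟨x, t, u, le_rfl, h3, fun a ha => by_contra fun hn => h1 _ ⟨a, hn, rfl⟩ ha,
      fun a ha => by_contra fun hn => h2 _ ⟨a, hn, rfl⟩ ha⟩
  · intro x s' t' u' hx hu
    obtain ⟨t, u, h1, h2, h3⟩ := exists_cocomp_of_disjoint hB x (u'.isFilterBase.image hmono)
      (t'.isIdealBase.image hmono) (by
        rintro _ ⟨a, ha, rfl⟩ _ ⟨b, hb, rfl⟩ c hc hle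
        rw [hB.rslash_le_iff, ← hf.map_rslash] at hle
        rcases hu _ _ (u'.mem_of_le (hA.le_par_rslash a b) ha) with hm | hm
        · exact hb hm
        · exact hc (x.mem_of_le hle (hx hm)))
    exact ⟨x, t, u, le_rfl, h1, fun a ha => h2 _ ⟨a, ha, rfl⟩,
      fun a ha => by_contra fun hn => h3 _ ⟨a, hn, rfl⟩ ha⟩
  · intro e
    change _ ↔ f mbot ∉ e
    rw [hf.map_mbot]
    rfl

/-- `θ` is a homomorphism. -/
theorem isBiAlgHom_theta {A : Type*} [HeytingAlgebra A] [BiOps A] (h : IsBasicBiBIAlgebra A)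
    [BasicBiBISpace (PrimeFilter A)] : IsBiAlgHom (theta (A := A)) where
  map_inf a b := SetLike.coe_injective (basic_inf a b)
  map_sup a b := SetLike.coe_injective (basic_sup a b)
  map_himp a b := by
    refine SetLike.coe_injective (compl_injective ?_)
    change (basic (a ⇨ b))ᶜ = (cHimp (basic a) (basic b))ᶜ
    rw [← lowerClosure_basic_diff]
    ext F
    simp [cHimp, mem_lowerClosure, and_comm]
  map_top := SetLike.coe_injective basic_top
  map_bot := SetLike.coe_injective basic_bot
  map_star a b := SetLike.coe_injective (cStar_basic h a b).symm
  map_wand a b := SetLike.coe_injective (cWand_basic h a b).symm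
  map_par a b := SetLike.coe_injective (cPar_basic h a b).symm
  map_rslash a b := SetLike.coe_injective (cRslash_basic h a b).symm
  map_mtop := rfl
  map_mbot := SetLike.coe_injective (compl_compl (basic mbot)).symm

end PrimeFilter

/-! ### The algebra of clopen upper sets -/

namespace ClopenUpperSet

section

variable {X : Type*} [TopologicalSpace X] [PartialOrder X] [BiFrameStr X] [BasicBiBISpace X]

/-- The order slack in `cStar` is absorbed because `C` is an up-set. -/
theorem star_le_iff {A B C : ClopenUpperSet X} :
    BiOps.star A B ≤ C ↔ ∀ x y z : X, x ∈ BiFrameStr.comp y z → y ∈ A → z ∈ B → x ∈ C :=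
  ⟨fun h x y z hx hy hz => h ⟨x, y, z, le_rfl, hx, hy, hz⟩,
    fun h _ ⟨w, y, z, hw, hw', hy, hz⟩ => C.upper hw (h w y z hw' hy hz)⟩

theorem star_comm_le (A B : ClopenUpperSet X) : BiOps.star A B ≤ BiOps.star B A :=
  star_le_iff.2 fun x y z hx hy hz => ⟨x, z, y, le_rfl, BIFrame.comp_comm _ _ _ hx, hz, hy⟩

theorem star_assoc_le (A B C : ClopenUpperSet X) :
    BiOps.star (BiOps.star A B) C ≤ BiOps.star A (BiOps.star B C) := by
  refine star_le_iff.2 fun w t' z hw ht' hz => ?_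
  obtain ⟨t, x, y, htt', ht, hx, hy⟩ := ht'
  obtain ⟨s, s', w', h1, h2, h3, h4⟩ := BIFrame.comp_assoc x y z t t' w htt' ht hw
  exact ⟨w', x, s', h3, h4, hx, s, y, z, h1, h2, hy, hz⟩

theorem le_wand_iff {A B C : ClopenUpperSet X} : BiOps.star A B ≤ C ↔ A ≤ wand B C := by
  rw [star_le_iff]
  exact ⟨fun h x hx w y z hw hz hy => h z w y hz (A.upper hw hx) hy,
    fun h x y z hx hy hz => h hy y z x le_rfl hx hz⟩

theorem isBasicBiBIAlgebra : IsBasicBiBIAlgebra (ClopenUpperSet X) where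
  star_comm A B := le_antisymm (star_comm_le A B) (star_comm_le B A)
  star_assoc A B C := by
    have comm : ∀ A B : ClopenUpperSet X, BiOps.star A B = BiOps.star B A :=
      fun A B => le_antisymm (star_comm_le A B) (star_comm_le B A)
    refine le_antisymm (star_assoc_le A B C) ?_
    -- Commuting every product turns the reverse inequality into `star_assoc_le` for `C`, `B`, `A`.
    rw [comm A, comm B, comm (BiOps.star A B), comm A B]
    exact star_assoc_le C B A
  star_mtop A := by
    refine le_antisymm (star_le_iff.2 fun x y e hx hy he =>
      A.upper (BIFrame.coherence x y e he hx) hy) fun x hx => ?_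
    obtain ⟨e, he, hxe⟩ := BIFrame.unit_exists x
    exact ⟨x, x, e, le_rfl, hxe, hx, he⟩
  le_wand_iff _ _ _ := le_wand_iff
  le_wand_iff' A B C := by
    rw [← le_wand_iff]
    exact ⟨(star_comm_le B A).trans, (star_comm_le A B).trans⟩
  par_comm := by
    have key : ∀ A B : ClopenUpperSet X, par A B ≤ par B A := fun A B x hx s t u hs hstu =>
      (hx s u t hs (BasicBiBIFrame.cocomp_comm _ _ _ hstu)).symm
    exact fun A B => le_antisymm (key A B) (key B A)
  rslash_le_iff A B C := by
    constructor
    · rintro h x ⟨s, t, u, hs, hu, hA, hB⟩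
      exact C.upper hs ((h hA u t s le_rfl hu).resolve_left hB)
    · intro h x hx s t u hs hstu
      exact or_iff_not_imp_left.2 fun ht => h ⟨u, t, s, le_rfl, hstu, A.upper hs hx, ht⟩

theorem holdsIn {σ : SubclassicalAxiom} (hσ : σ.FrameHolds X) : σ.HoldsIn (ClopenUpperSet X) := by
  cases σ with
  | associativity =>
    intro A B C x hx w t' z hw hwtz
    by_contra! hc
    refine hc.1 fun t x' y htt ht => ?_
    by_contra! hc'
    obtain ⟨s, s', w', h1, h2, h3, h4⟩ := hσ x' y z t t' w htt ht hwtz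
    have hs := (hx w' x' s' (hw.trans h3) h4).resolve_left hc'.1
    exact (hs s y z h1 h2).elim hc'.2 hc.2
  | mbotWeakening =>
    intro A x hx s t u hs hstu
    exact or_iff_not_imp_right.2 fun hu =>
      A.upper (hs.trans (hσ s t u (not_not.1 hu) hstu)) hx
  | mbotContraction =>
    intro A x hx
    obtain ⟨u, hu, hxu⟩ := hσ x
    exact (hx x x u le_rfl hxu).resolve_right fun h => h hu
  | parContraction =>
    intro A x hx
    exact (hx x x x le_rfl (hσ x)).elim id id
  | weakDistributivity =>
    rintro A B C t' ⟨t, x₁, x₂, htt', ht, h1, h2⟩ t'' y₁ y₂ ht' ht''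
    obtain ⟨w, hw1, hw2⟩ := hσ x₁ x₂ y₁ y₂ t t' t'' htt' ht ht' ht''
    exact (h2 x₂ w y₂ le_rfl hw2).imp_left fun hw => ⟨y₁, x₁, w, le_rfl, hw1, h1, hw⟩

end

theorem isBiAlgebra {v : BiVariant} {Ax : Set SubclassicalAxiom} {X : Type*} [TopologicalSpace X]
    [PartialOrder X] [BiFrameStr X] [BasicBiBISpace X] (h : IsBiSpace v Ax X) :
    IsBiAlgebra v Ax (ClopenUpperSet X) where
  toIsBasicBiBIAlgebra := isBasicBiBIAlgebra
  boolean hv A := by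
    refine top_le_iff.1 fun x _ => ?_
    by_cases hx : x ∈ A
    · exact Or.inl hx
    · refine Or.inr ?_
      -- When the order is equality, `A ⇒ ∅` is the set complement of `A`.
      have hc : x ∈ cHimp (A : Set X) (⊥ : ClopenUpperSet X) := fun x' hxx' hx' =>
        absurd ((h.discrete hv x x' hxx').symm ▸ hx') hx
      exact hc
  holds σ hσ := holdsIn (h.holds σ hσ)

/-- For each relational operation, the forth conditions give one inclusion and the matching back
condition the other. Back conditions hold only up to the order, which suffices for up-sets. -/
theorem isBiAlgHom_comap {X Y : Type*} [TopologicalSpace X] [PartialOrder X] [BiFrameStr X]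
    [BasicBiBISpace X] [TopologicalSpace Y] [PartialOrder Y] [BiFrameStr Y] [BasicBiBISpace Y]
    {g : X → Y} (hg : IsBiSpaceHom g) : IsBiAlgHom (comap g hg.continuous hg.mono) where
  map_inf _ _ := rfl
  map_sup _ _ := rfl
  map_top := rfl
  map_bot := rfl
  map_himp A B := by
    refine le_antisymm (fun x hx x' hxx' hx' => hx _ (hg.mono _ _ hxx') hx')
      fun x hx y' hy' hA => ?_
    obtain ⟨y, hxy, rfl⟩ := hg.back x y' hy'
    exact hx y hxy hA
  map_star A B := by
    refine le_antisymm ?_ ?_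
    · rintro x ⟨w', y', z', hw, hw', hA, hB⟩
      obtain ⟨w, y, z, h1, h2, h3, h4⟩ := hg.comp_back x w' y' z' hw hw'
      exact ⟨w, y, z, h1, h2, A.upper h3 hA, B.upper h4 hB⟩
    · rintro x ⟨w, y, z, hw, hw', hA, hB⟩
      exact ⟨g w, g y, g z, hg.mono _ _ hw, hg.comp_forth _ _ _ hw', hA, hB⟩
  map_wand A B := by
    refine le_antisymm
      (fun x hx w y z hw hz hA => hx _ _ _ (hg.mono _ _ hw) (hg.comp_forth _ _ _ hz) hA)
      fun x hx w' y' z' hw hz hA => ?_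
    obtain ⟨w, y, z, h1, h2, h3, h4⟩ := hg.wand_back x w' y' z' hw hz
    exact B.upper h4 (hx w y z h1 h2 (A.upper h3 hA))
  map_par A B := by
    refine le_antisymm
      (fun x hx s t u hs hstu => hx _ _ _ (hg.mono _ _ hs) (hg.cocomp_forth _ _ _ hstu))
      fun x hx s' t' u' hs hstu => ?_
    obtain ⟨s, t, u, h1, h2, h3, h4⟩ := hg.par_back x s' t' u' hs hstu
    exact (hx s t u h1 h2).imp (fun h => A.upper h3 h) fun h => B.upper h4 h
  map_rslash A B := by
    refine le_antisymm ?_ ?_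
    · rintro x ⟨s', t', u', hs, hu, hA, hB⟩
      obtain ⟨s, t, u, h1, h2, h3, h4⟩ := hg.rslash_back x s' t' u' hs hu
      exact ⟨s, t, u, h1, h2, A.upper h3 hA, fun h => hB (B.upper h4 h)⟩
    · rintro x ⟨s, t, u, hs, hu, hA, hB⟩
      exact ⟨g s, g t, g u, hg.mono _ _ hs, hg.cocomp_forth _ _ _ hu, hA, hB⟩
  map_mtop := SetLike.ext fun x => (hg.mem_E_iff x).symm
  map_mbot := SetLike.ext fun x => not_congr (hg.mem_U_iff x).symm

end ClopenUpperSet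

/-! ### Isomorphisms -/

/-- Homeomorphisms preserving and reflecting all the structure. -/
structure IsBiSpaceIso {X Y : Type*} [TopologicalSpace X] [PartialOrder X] [BiFrameStr X]
    [TopologicalSpace Y] [PartialOrder Y] [BiFrameStr Y] (g : X ≃ₜ Y) : Prop where
  le_iff : ∀ x y, g x ≤ g y ↔ x ≤ y
  comp_iff : ∀ x y z, g x ∈ BiFrameStr.comp (g y) (g z) ↔ x ∈ BiFrameStr.comp y z
  mem_E_iff : ∀ x, g x ∈ (E : Set Y) ↔ x ∈ (E : Set X)
  cocomp_iff : ∀ x y z, g x ∈ cocomp (g y) (g z) ↔ x ∈ cocomp y z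
  mem_U_iff : ∀ x, g x ∈ (U : Set Y) ↔ x ∈ (U : Set X)

namespace IsBiSpaceIso

variable {X Y : Type*} [TopologicalSpace X] [PartialOrder X] [BiFrameStr X]
    [TopologicalSpace Y] [PartialOrder Y] [BiFrameStr Y] {g : X ≃ₜ Y}

theorem symm (hg : IsBiSpaceIso g) : IsBiSpaceIso g.symm where
  le_iff x y := by rw [← hg.le_iff]; simp
  comp_iff x y z := by rw [← hg.comp_iff]; simp
  mem_E_iff x := by rw [← hg.mem_E_iff]; simp
  cocomp_iff x y z := by rw [← hg.cocomp_iff]; simp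
  mem_U_iff x := by rw [← hg.mem_U_iff]; simp

/-- Surjectivity supplies exact preimages as witnesses for the back conditions, so no order slack is
needed. -/
theorem isBiSpaceHom (hg : IsBiSpaceIso g) : IsBiSpaceHom g where
  continuous := g.continuous
  mono x y := (hg.le_iff x y).2
  back x y' h := by
    obtain ⟨y, rfl⟩ := g.surjective y'
    exact ⟨y, (hg.le_iff _ _).1 h, rfl⟩
  comp_forth x y z := (hg.comp_iff x y z).2
  comp_back x w' y' z' h h' := by
    obtain ⟨w, rfl⟩ := g.surjective w'
    obtain ⟨y, rfl⟩ := g.surjective y'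
    obtain ⟨z, rfl⟩ := g.surjective z'
    exact ⟨w, y, z, (hg.le_iff _ _).1 h, (hg.comp_iff _ _ _).1 h', le_rfl, le_rfl⟩
  wand_back x w' y' z' h h' := by
    obtain ⟨w, rfl⟩ := g.surjective w'
    obtain ⟨y, rfl⟩ := g.surjective y'
    obtain ⟨z, rfl⟩ := g.surjective z'
    exact ⟨w, y, z, (hg.le_iff _ _).1 h, (hg.comp_iff _ _ _).1 h', le_rfl, le_rfl⟩
  dnaw_back x w' y' z' h h' := by
    obtain ⟨w, rfl⟩ := g.surjective w'
    obtain ⟨y, rfl⟩ := g.surjective y'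
    obtain ⟨z, rfl⟩ := g.surjective z'
    exact ⟨w, y, z, (hg.le_iff _ _).1 h, (hg.comp_iff _ _ _).1 h', le_rfl, le_rfl⟩
  mem_E_iff x := (hg.mem_E_iff x).symm
  cocomp_forth x y z := (hg.cocomp_iff x y z).2
  par_back x s' t' u' h h' := by
    obtain ⟨s, rfl⟩ := g.surjective s'
    obtain ⟨t, rfl⟩ := g.surjective t'
    obtain ⟨u, rfl⟩ := g.surjective u'
    exact ⟨s, t, u, (hg.le_iff _ _).1 h, (hg.cocomp_iff _ _ _).1 h', le_rfl, le_rfl⟩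
  rslash_back x s' t' u' h h' := by
    obtain ⟨s, rfl⟩ := g.surjective s'
    obtain ⟨t, rfl⟩ := g.surjective t'
    obtain ⟨u, rfl⟩ := g.surjective u'
    exact ⟨s, t, u, (hg.le_iff _ _).1 h, (hg.cocomp_iff _ _ _).1 h', le_rfl, le_rfl⟩
  mem_U_iff x := (hg.mem_U_iff x).symm

end IsBiSpaceIso

/-- The two separation axioms, read contrapositively, say that `η` reflects `∘` and `▽`;
preservation is immediate from the definitions of `•` and `▼`. -/
theorem ClopenUpperSet.isBiSpaceIso_etaHomeomorph {X : Type*} [TopologicalSpace X] [PartialOrder X]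
    [BiFrameStr X] [BasicBiBISpace X] : IsBiSpaceIso (etaHomeomorph (X := X)) where
  le_iff _ _ := eta_le_eta
  comp_iff x y z := by
    constructor
    · intro h
      by_contra hx
      obtain ⟨C, D, hC, hD, hCD⟩ := ILGLSpace.comp_separation x y z hx
      exact hCD (h C hC D hD)
    · exact fun h C hC D hD => ⟨x, y, z, le_rfl, h, hC, hD⟩
  mem_E_iff _ := Iff.rfl
  cocomp_iff x y z := by
    constructor
    · intro h
      by_contra hx
      obtain ⟨C, D, hC, hD, hCD⟩ := BasicBiBISpace.cocomp_separation x y z hx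
      exact (h C D hCD).elim hC hD
    · exact fun h C D hCD => hCD x y z le_rfl h
  mem_U_iff _ := not_not

namespace IsBiAlgHom

variable {A B : Type*} [HeytingAlgebra A] [BiOps A] [HeytingAlgebra B] [BiOps B]

/-- The inverse of a bijective homomorphism is a homomorphism. -/
theorem symm {e : A ≃ B} (he : IsBiAlgHom e) : IsBiAlgHom e.symm := by
  constructor <;> intros <;> apply e.injective <;>
    simp only [he.map_inf, he.map_sup, he.map_himp, he.map_top, he.map_bot, he.map_star,
      he.map_wand, he.map_par, he.map_rslash, he.map_mtop, he.map_mbot, Equiv.apply_symm_apply]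

end IsBiAlgHom

/-- A bijective homomorphism is an isomorphism in `BiAlg`. -/
noncomputable def BiAlg.isoOfBijective {v : BiVariant} {Ax : Set SubclassicalAxiom}
    {A B : BiAlg.{u} v Ax} (f : BiAlg.Hom A B) (hf : Function.Bijective f.toFun) : A ≅ B where
  hom := f
  inv := BiAlg.Hom.mk (Equiv.ofBijective f.toFun hf).symm
    (IsBiAlgHom.symm (e := Equiv.ofBijective f.toFun hf) f.isHom)
  hom_inv_id := BiAlg.Hom.ext (funext (Equiv.ofBijective f.toFun hf).symm_apply_apply)
  inv_hom_id := BiAlg.Hom.ext (funext (Equiv.ofBijective f.toFun hf).apply_symm_apply)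

/-- A structure preserving homeomorphism is an isomorphism in `BiSp`. -/
def BiSp.isoOfHomeomorph {v : BiVariant} {Ax : Set SubclassicalAxiom} {X Y : BiSp.{u} v Ax}
    (g : X ≃ₜ Y) (hg : IsBiSpaceIso g) : X ≅ Y where
  hom := BiSp.Hom.mk g hg.isBiSpaceHom
  inv := BiSp.Hom.mk g.symm hg.symm.isBiSpaceHom
  hom_inv_id := BiSp.Hom.ext (funext g.symm_apply_apply)
  inv_hom_id := BiSp.Hom.ext (funext g.apply_symm_apply)

/-! ### Assembly of the dual equivalence -/

theorem mainTheorem11 (v : BiVariant) (Ax : Set SubclassicalAxiom) :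
    ∃ (hPr : ∀ A : BiAlg.{u} v Ax, IsBiSpace v Ax (PrimeFilter A))
      (hPrMap : ∀ (A B : BiAlg.{u} v Ax) (f : A ⟶ B), IsBiSpaceHom (prMap f))
      (hClop : ∀ X : BiSp.{u} v Ax, IsBiAlgebra v Ax (ClopenUpperSet X))
      (hClopMap : ∀ (X Y : BiSp.{u} v Ax) (g : X ⟶ Y), IsBiAlgHom (clopMap g))
      (hθ : ∀ A : BiAlg.{u} v Ax,
        IsBiAlgHom (A := A) (B := (clopFunctor hClop hClopMap).obj ((prFunctor hPr hPrMap).obj A))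
          PrimeFilter.theta)
      (hη : ∀ X : BiSp.{u} v Ax,
        IsBiSpaceHom (X := X)
          (Y := ((prFunctor hPr hPrMap).obj ((clopFunctor hClop hClopMap).obj (op X))).unop)
          ClopenUpperSet.eta),
      IsDualEquivalence (prFunctor hPr hPrMap) (clopFunctor hClop hClopMap)
        (fun A => BiAlg.Hom.mk PrimeFilter.theta (hθ A))
        (fun X => BiSp.Hom.mk ClopenUpperSet.eta (hη X)) := by
  refine ⟨fun A => PrimeFilter.isBiSpace A.isBiAlgebra,
    fun A B f => PrimeFilter.isBiSpaceHom_comap B.isBiAlgebra.toIsBasicBiBIAlgebra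
      A.isBiAlgebra.toIsBasicBiBIAlgebra f.isHom,
    fun X => ClopenUpperSet.isBiAlgebra X.isBiSpace,
    fun X Y g => ClopenUpperSet.isBiAlgHom_comap g.isHom,
    fun A => @PrimeFilter.isBiAlgHom_theta A _ _ A.isBiAlgebra.toIsBasicBiBIAlgebra
      (PrimeFilter.basicBiBISpace A.isBiAlgebra.toIsBasicBiBIAlgebra),
    fun X => ClopenUpperSet.isBiSpaceIso_etaHomeomorph.isBiSpaceHom, ?_⟩
  refine ⟨NatIso.ofComponents (fun A => BiAlg.isoOfBijective (BiAlg.Hom.mk PrimeFilter.theta _)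
      ⟨PrimeFilter.theta_injective, PrimeFilter.theta_surjective⟩) ?_,
    NatIso.ofComponents (fun X => (BiSp.isoOfHomeomorph (X := X.unop) 
      (Y := ⟨PrimeFilter (ClopenUpperSet X.unop),
        PrimeFilter.isBiSpace (ClopenUpperSet.isBiAlgebra X.unop.isBiSpace)⟩)
      (ClopenUpperSet.etaHomeomorph (X := X.unop))
      ClopenUpperSet.isBiSpaceIso_etaHomeomorph).op) ?_, ?_, fun A => rfl, fun X => rfl⟩
  -- Naturality of `θ` is definitional: `F ∈ θ (f a)` and `f⁻¹ F ∈ θ a` both unfold to `f a ∈ F`.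
  -- Naturality of `η` is similar, and the triangle identity unfolds to `a ∈ F ↔ F ∈ θ a`.
  · intro A B f
    rfl
  · intro X Y g
    rfl
  · intro A
    rfl
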